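/- Lie groups are real, finite-dimensional, smooth and second countable. A Lie group crossed module $(G_1\xrightarrow{\mu}G_0)$ is a Lie group homomorphism $\mu$ together with a smooth action $\triangleright$ of $G_0$ on $G_1$ by automorphisms such that $\mu(g_1)\triangleright g_1'=g_1g_1'g_1^{-1}$ and $\mu(g_0\triangleright g_1)=g_0\,\mu(g_1)\,g_0^{-1}$. For a Lie group crossed module $(H_1\xrightarrow{\partial}H_0)$, let $\mathrm{Der}(H_0,H_1)$ be the monoid of smooth maps $\gamma:H_0\to H_1$ with $\gamma(hh')=\gamma(h)\cdot(h\triangleright\gamma(h'))$, with product $(\gamma_1\star\gamma_2)(h)=\gamma_1(\partial\gamma_2(h)\cdot h)\cdot\gamma_2(h)$; let $D(H_0,H_1)$ be its group of units and $\mathrm{Aut}(H_1,H_0,\partial)$ the group of automorphisms of the crossed module. An action $(\alpha,\beta)$ of $(G_1\xrightarrow{\mu}G_0)$ on $(H_1\xrightarrow{\partial}H_0)$ is a pair of group homomorphisms $\alpha:G_1\to D(H_0,H_1)$ and $\beta=(\beta_1,\beta_0):G_0\to\mathrm{Aut}(H_1,H_0,\partial)$, smooth in the sense that the induced maps $G_1\times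 H_0\to H_1$, $G_0\times H_1\to H_1$, $G_0\times H_0\to H_0$ are smooth, such that $\alpha(g_0\triangleright g_1)=\beta_1(g_0)\circ\alpha(g_1)\circ\beta_0(g_0)^{-1}$, $\beta_1(\mu g_1)h_1=\alpha(g_1)(\partial h_1)\cdot h_1$ and $\beta_0(\mu g_1)h_0=\partial(\alpha(g_1)h_0)\cdot h_0$. A relative Rota-Baxter operator with respect to $(\alpha,\beta)$ is a pair of smooth maps $\mathcal B_i:H_i\to G_i$ $(i=0,1)$ with $\mu\circ\mathcal B_1=\mathcal B_0\circ\partial$ such that $\mathcal B_1h\cdot\mathcal B_1h'=\mathcal B_1(h\cdot\beta_1(\mu\mathcal B_1h)h')$ for $h,h'\in H_1$, $\mathcal B_0h\cdot\mathcal B_0h'=\mathcal B_0(h\cdot\beta_0(\mathcal B_0h)h')$ for $h,h'\in H_0$, and, for $h_0\in H_0$, $h_1\in H_1$, $$\mathcal B_0h_0\triangleright\mathcal B_1h_1=\mathcal B_1\big(h_0\triangleright(\beta_1(\mathcal B_0h_0)h_1\cdot\alpha(\mathcal B_0h_0\triangleright\mathcal B_1h_1)h_0^{-1})\big).$$ A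 crossed homomorphism with respect to $(\alpha,\beta)$ is a pair of smooth maps $\mathcal D_i:G_i\to H_i$ with $\partial\circ\mathcal D_1=\mathcal D_0\circ\mu$ such that $\mathcal D_1(gg')=\mathcal D_1g\cdot\beta_1(\mu g)\mathcal D_1g'$ for $g,g'\in G_1$, $\mathcal D_0(gg')=\mathcal D_0g\cdot\beta_0(g)\mathcal D_0g'$ for $g,g'\in G_0$, and, for $g_0\in G_0$, $g_1\in G_1$, $$\mathcal D_1(g_0\triangleright g_1)=\mathcal D_0g_0\triangleright\big(\beta_1(g_0)\mathcal D_1g_1\cdot\alpha(g_0\triangleright g_1)(\mathcal D_0g_0)^{-1}\big).$$ Theorem. Let $(\alpha,\beta)$ be an action of a Lie group crossed module $(G_1\xrightarrow{\mu}G_0)$ on a Lie group crossed module $(H_1\xrightarrow{\partial}H_0)$. (i) If $(\mathcal B_1,\mathcal B_0)$ is a relative Rota-Baxter operator with respect to $(\alpha,\beta)$ and $\mathcal B_1,\mathcal B_0$ are bijective, then the pair of inverse maps $(\mathcal B_1^{-1},\mathcal B_0^{-1})$ is a crossed homomorphism with respect to $(\alpha,\beta)$ (in particular, it is smooth). (ii)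 Let $(\mathcal D_1,\mathcal D_0)$ be a crossed homomorphism with respect to $(\alpha,\beta)$, and let $D_i=(\mathcal D_i)_{*e}:\mathfrak g_i\to\mathfrak h_i$ be the differentials at the identity. Let $\bar\mu,\bar\partial$ be the differentials of $\mu,\partial$ at the identity, and let $\triangleright$ (on $\mathfrak g_0\times\mathfrak g_1$ and on $\mathfrak h_0\times\mathfrak h_1$), $\bar\alpha$, $\bar\beta_1$, $\bar\beta_0$ be the infinitesimal actions obtained by differentiating both variables of the corresponding group-level maps at the identities, e.g. $\bar\alpha(\xi)u=\frac{d}{ds}\frac{d}{dt}\big|_{s=t=0}\alpha(\exp(s\xi))\exp(tu)$. Then $(D_1,D_0)$ is a crossed homomorphism of the Lie algebra crossed modules with respect to $(\bar\alpha,\bar\beta)$; that is, $D_1,D_0$ are linear, $\bar\partial\circ D_1=D_0\circ\bar\mu$, and $$D_1[\xi,\eta]=\bar\beta_1(\bar\mu\xi)D_1\eta-\bar\beta_1(\bar\mu\eta)D_1\xi+[D_1\xi,D_1\eta],\qquad D_0[x,y]=\bar\beta_0(x)D_0y-\bar\beta_0(y)D_0x+[D_0x,D_0y],$$ $$D_1(x\triangleright\xi)=\bar\beta_1(x)D_1\xi-\bar\alpha(\xi)D_0x+D_0x\triangleright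 D_1\xi$$ for all $x,y\in\mathfrak g_0$ and $\xi,\eta\in\mathfrak g_1$. -/

import Mathlib

open scoped Manifold ContDiff

noncomputable section

/-! ### Lie group crossed modules -/

section Groups

/-- A Lie group crossed module `μ : G₁ → G₀`.  The action of `G₀` on `G₁` by automorphisms is
smooth in the usual sense: the map `(g₀, g₁) ↦ g₀ ▷ g₁` is smooth on `G₀ × G₁`. -/
structure LieCrossedModule
    (E₁ : Type*) [NormedAddCommGroup E₁] [NormedSpace ℝ E₁]
    (G₁ : Type*) [Group G₁] [TopologicalSpace G₁] [ChartedSpace E₁ G₁]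
    (E₀ : Type*) [NormedAddCommGroup E₀] [NormedSpace ℝ E₀]
    (G₀ : Type*) [Group G₀] [TopologicalSpace G₀] [ChartedSpace E₀ G₀] where
  /-- the structure homomorphism -/
  bd : G₁ →* G₀
  /-- the action `▷` of `G₀` on `G₁` by automorphisms -/
  act : G₀ →* MulAut G₁
  contMDiff_bd : ContMDiff 𝓘(ℝ, E₁) 𝓘(ℝ, E₀) ∞ bd
  contMDiff_act : ContMDiff (𝓘(ℝ, E₀).prod 𝓘(ℝ, E₁)) 𝓘(ℝ, E₁) ∞
    (fun p : G₀ × G₁ => act p.1 p.2)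
  act_bd : ∀ g g' : G₁, act (bd g) g' = g * g' * g⁻¹
  bd_act : ∀ (g₀ : G₀) (g₁ : G₁), bd (act g₀ g₁) = g₀ * bd g₁ * g₀⁻¹

variable {E₁ : Type*} [NormedAddCommGroup E₁] [NormedSpace ℝ E₁]
  {H₁ : Type*} [Group H₁] [TopologicalSpace H₁] [ChartedSpace E₁ H₁]
  {E₀ : Type*} [NormedAddCommGroup E₀] [NormedSpace ℝ E₀]
  {H₀ : Type*} [Group H₀] [TopologicalSpace H₀] [ChartedSpace E₀ H₀]

/-! ### The actor crossed module -/

/-- The group `Aut(H₁, H₀, ∂)` of automorphisms of a Lie group crossed module: pairs of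
Lie group automorphisms that commute with `∂` and are compatible with the actions. -/
def LieCrossedModule.Aut (X : LieCrossedModule E₁ H₁ E₀ H₀) :
    Subgroup (MulAut H₁ × MulAut H₀) where
  carrier := {f |
    (ContMDiff 𝓘(ℝ, E₁) 𝓘(ℝ, E₁) ∞ (fun h => f.1 h) ∧
      ContMDiff 𝓘(ℝ, E₁) 𝓘(ℝ, E₁) ∞ (fun h => f.1⁻¹ h)) ∧
    (ContMDiff 𝓘(ℝ, E₀) 𝓘(ℝ, E₀) ∞ (fun h => f.2 h) ∧
      ContMDiff 𝓘(ℝ, E₀) 𝓘(ℝ, E₀) ∞ (fun h => f.2⁻¹ h)) ∧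
    (∀ h₁, X.bd (f.1 h₁) = f.2 (X.bd h₁)) ∧
    (∀ h₀ h₁, f.1 (X.act h₀ h₁) = X.act (f.2 h₀) (f.1 h₁))}
  one_mem' := by
    exact ⟨⟨contMDiff_id, contMDiff_id⟩, ⟨contMDiff_id, contMDiff_id⟩, fun _ => rfl,
      fun _ _ => rfl⟩
  mul_mem' := by
    rintro f g ⟨⟨f1, f1'⟩, ⟨f0, f0'⟩, fb, fa⟩ ⟨⟨g1, g1'⟩, ⟨g0, g0'⟩, gb, ga⟩
    refine ⟨⟨f1.comp g1, ?_⟩, ⟨f0.comp g0, ?_⟩, ?_, ?_⟩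
    · simpa [Function.comp_def] using g1'.comp f1'
    · simpa [Function.comp_def] using g0'.comp f0'
    · intro h; simp [fb, gb]
    · intro h k; simp [fa, ga]
  inv_mem' := by
    rintro f ⟨⟨f1, f1'⟩, ⟨f0, f0'⟩, fb, fa⟩
    refine ⟨⟨f1', by simpa using f1⟩, ⟨f0', by simpa using f0⟩, ?_, ?_⟩
    · intro h
      apply f.2.injective
      rw [← fb]; simp
    · intro h k
      apply f.1.injective
      rw [fa]; simp

/-- Derivations from `H₀` to `H₁`: smooth maps `γ` with `γ(h h') = γ(h) · (h ▷ γ(h'))`. -/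
@[ext]
structure LieCrossedModule.Derivation (X : LieCrossedModule E₁ H₁ E₀ H₀) where
  toFun : H₀ → H₁
  contMDiff_toFun : ContMDiff 𝓘(ℝ, E₀) 𝓘(ℝ, E₁) ∞ toFun
  map_mul' : ∀ h h' : H₀, toFun (h * h') = toFun h * X.act h (toFun h')

namespace LieCrossedModule.Derivation

variable {X : LieCrossedModule E₁ H₁ E₀ H₀}

theorem map_one' (γ : X.Derivation) : γ.toFun 1 = 1 := by
  have h := γ.map_mul' 1 1
  simpa using h

/-- `h ↦ ∂γ(h) · h` is multiplicative. -/
theorem bd_mul_hom (γ : X.Derivation) (h k : H₀) :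
    X.bd (γ.toFun (h * k)) * (h * k) = X.bd (γ.toFun h) * h * (X.bd (γ.toFun k) * k) := by
  rw [γ.map_mul', map_mul, X.bd_act]; group

/-- `h ↦ γ(∂h) · h` is multiplicative. -/
theorem mul_hom (γ : X.Derivation) (h k : H₁) :
    γ.toFun (X.bd (h * k)) * (h * k) = γ.toFun (X.bd h) * h * (γ.toFun (X.bd k) * k) := by
  rw [map_mul, γ.map_mul', X.act_bd]; group

variable [LieGroup 𝓘(ℝ, E₁) ∞ H₁] [LieGroup 𝓘(ℝ, E₀) ∞ H₀]

/-- The multiplication `(γ₁ ⋆ γ₂)(h) = γ₁(∂γ₂(h) · h) · γ₂(h)` of derivations, whose unit is the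
trivial derivation. -/
instance : Monoid X.Derivation where
  mul γ₁ γ₂ :=
    { toFun := fun h => γ₁.toFun (X.bd (γ₂.toFun h) * h) * γ₂.toFun h
      contMDiff_toFun :=
        (γ₁.contMDiff_toFun.comp
          ((X.contMDiff_bd.comp γ₂.contMDiff_toFun).mul contMDiff_id)).mul γ₂.contMDiff_toFun
      map_mul' := fun h k => by
        rw [γ₂.bd_mul_hom, γ₁.map_mul', γ₂.map_mul', map_mul X.act, MulAut.mul_apply, X.act_bd]
        simp only [map_mul]
        group }
  one :=
    { toFun := fun _ => 1
      contMDiff_toFun := contMDiff_const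
      map_mul' := by simp }
  mul_assoc γ₁ γ₂ γ₃ := by
    apply LieCrossedModule.Derivation.ext
    funext h
    change γ₁.toFun (X.bd (γ₃.toFun h) * h |> fun y => X.bd (γ₂.toFun y) * y) *
        γ₂.toFun (X.bd (γ₃.toFun h) * h) * γ₃.toFun h =
      γ₁.toFun (X.bd (γ₂.toFun (X.bd (γ₃.toFun h) * h) * γ₃.toFun h) * h) *
        (γ₂.toFun (X.bd (γ₃.toFun h) * h) * γ₃.toFun h)
    simp only [map_mul, mul_assoc]
  one_mul γ := by
    apply LieCrossedModule.Derivation.ext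
    funext h
    exact one_mul _
  mul_one γ := by
    apply LieCrossedModule.Derivation.ext
    funext h
    change γ.toFun (X.bd 1 * h) * 1 = γ.toFun h
    simp

theorem one_toFun (h : H₀) : (1 : X.Derivation).toFun h = 1 := rfl

theorem mul_toFun (γ₁ γ₂ : X.Derivation) (h : H₀) :
    (γ₁ * γ₂).toFun h = γ₁.toFun (X.bd (γ₂.toFun h) * h) * γ₂.toFun h := rfl

theorem comp_one (γ δ : X.Derivation) (e : γ * δ = 1) (h : H₁) :
    γ.toFun (X.bd (δ.toFun (X.bd h) * h)) * (δ.toFun (X.bd h) * h) = h := by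
  have := congrArg (fun η : X.Derivation => η.toFun (X.bd h)) e
  simp only [mul_toFun, one_toFun] at this
  rw [map_mul, ← mul_assoc, this, one_mul]

theorem comp_zero (γ δ : X.Derivation) (e : γ * δ = 1) (h : H₀) :
    X.bd (γ.toFun (X.bd (δ.toFun h) * h)) * (X.bd (δ.toFun h) * h) = h := by
  have := congrArg (fun η : X.Derivation => X.bd (η.toFun h)) e
  simp only [mul_toFun, one_toFun, map_mul, map_one] at this
  rw [← mul_assoc, this, one_mul]

end LieCrossedModule.Derivation

namespace LieCrossedModule

variable (X : LieCrossedModule E₁ H₁ E₀ H₀)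
  [LieGroup 𝓘(ℝ, E₁) ∞ H₁] [LieGroup 𝓘(ℝ, E₀) ∞ H₀]

/-- The structure map `Δ : D(H₀, H₁) → Aut(H₁, H₀, ∂)` of the actor crossed module, where
`D(H₀, H₁)` is the group of units of the monoid of derivations:
`Δ(γ)(h₁, h₀) = (γ(∂h₁) · h₁, ∂γ(h₀) · h₀)`. -/
def actorBd : (X.Derivation)ˣ →* X.Aut where
  toFun γ := ⟨
    ({ toFun := fun h => γ.val.toFun (X.bd h) * h
       invFun := fun h => γ.inv.toFun (X.bd h) * h
       left_inv := fun h => Derivation.comp_one _ _ γ.inv_val h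
       right_inv := fun h => Derivation.comp_one _ _ γ.val_inv h
       map_mul' := γ.val.mul_hom },
     { toFun := fun h => X.bd (γ.val.toFun h) * h
       invFun := fun h => X.bd (γ.inv.toFun h) * h
       left_inv := fun h => Derivation.comp_zero _ _ γ.inv_val h
       right_inv := fun h => Derivation.comp_zero _ _ γ.val_inv h
       map_mul' := γ.val.bd_mul_hom }),
    ⟨(γ.val.contMDiff_toFun.comp X.contMDiff_bd).mul contMDiff_id,
      (γ.inv.contMDiff_toFun.comp X.contMDiff_bd).mul contMDiff_id⟩,
    ⟨(X.contMDiff_bd.comp γ.val.contMDiff_toFun).mul contMDiff_id,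
      (X.contMDiff_bd.comp γ.inv.contMDiff_toFun).mul contMDiff_id⟩,
    fun h => by
      change X.bd (γ.val.toFun (X.bd h) * h) = X.bd (γ.val.toFun (X.bd h)) * X.bd h
      rw [map_mul],
    fun h k => by
      change γ.val.toFun (X.bd (X.act h k)) * X.act h k =
        X.act (X.bd (γ.val.toFun h) * h) (γ.val.toFun (X.bd k) * k)
      have e : γ.val.toFun (h * X.bd k * h⁻¹) * (X.act h k * γ.val.toFun h) =
          γ.val.toFun h * X.act h (γ.val.toFun (X.bd k) * k) := by
        have e1 := γ.val.map_mul' (h * X.bd k * h⁻¹) h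
        have e2 := γ.val.map_mul' h (X.bd k)
        have e3 : h * X.bd k * h⁻¹ * h = h * X.bd k := by group
        rw [e3, e2, ← X.bd_act, X.act_bd] at e1
        rw [map_mul, ← mul_assoc, ← mul_assoc, e1, X.bd_act]
        group
      rw [map_mul X.act, MulAut.mul_apply, X.act_bd, X.bd_act, ← e]
      group⟩
  map_one' := by
    apply Subtype.ext
    refine Prod.ext (MulEquiv.ext fun h => ?_) (MulEquiv.ext fun h => ?_)
    · exact one_mul h
    · change X.bd 1 * h = h
      simp
  map_mul' γ δ := by
    apply Subtype.ext
    refine Prod.ext (MulEquiv.ext fun h => ?_) (MulEquiv.ext fun h => ?_)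
    · change γ.val.toFun (X.bd (δ.val.toFun (X.bd h)) * X.bd h) * δ.val.toFun (X.bd h) * h =
        γ.val.toFun (X.bd (δ.val.toFun (X.bd h) * h)) * (δ.val.toFun (X.bd h) * h)
      rw [map_mul, mul_assoc]
    · change X.bd (γ.val.toFun (X.bd (δ.val.toFun h) * h) * δ.val.toFun h) * h =
        X.bd (γ.val.toFun (X.bd (δ.val.toFun h) * h)) * (X.bd (δ.val.toFun h) * h)
      rw [map_mul, mul_assoc]

/-- An automorphism `(ε, ρ)` acts on derivations by `γ ↦ ε ∘ γ ∘ ρ⁻¹`. -/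
def autConj (f : X.Aut) : X.Derivation →* X.Derivation where
  toFun γ :=
    { toFun := fun h => f.val.1 (γ.toFun (f.val.2⁻¹ h))
      contMDiff_toFun := f.property.1.1.comp (γ.contMDiff_toFun.comp f.property.2.1.2)
      map_mul' := fun h k => by
        rw [map_mul, γ.map_mul', map_mul, f.property.2.2.2]
        simp }
  map_one' := by
    apply Derivation.ext
    funext h
    exact map_one f.val.1
  map_mul' γ δ := by
    apply Derivation.ext
    funext h
    change f.val.1 (γ.toFun (X.bd (δ.toFun (f.val.2⁻¹ h)) * f.val.2⁻¹ h) *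
        δ.toFun (f.val.2⁻¹ h)) =
      f.val.1 (γ.toFun (f.val.2⁻¹ (X.bd (f.val.1 (δ.toFun (f.val.2⁻¹ h))) * h))) *
        f.val.1 (δ.toFun (f.val.2⁻¹ h))
    rw [map_mul, f.property.2.2.1, map_mul f.val.2⁻¹]
    simp

/-- The action `(ε, ρ) ▷ γ = ε ∘ γ ∘ ρ⁻¹` of `Aut(H₁, H₀, ∂)` on `D(H₀, H₁)` in the actor
crossed module. -/
def actorAct (f : X.Aut) : (X.Derivation)ˣ →* (X.Derivation)ˣ :=
  Units.map (X.autConj f)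

end LieCrossedModule

/-! ### Actions of crossed modules, and operators on them -/

variable {F₁ : Type*} [NormedAddCommGroup F₁] [NormedSpace ℝ F₁]
  {G₁ : Type*} [Group G₁] [TopologicalSpace G₁] [ChartedSpace F₁ G₁]
  {F₀ : Type*} [NormedAddCommGroup F₀] [NormedSpace ℝ F₀]
  {G₀ : Type*} [Group G₀] [TopologicalSpace G₀] [ChartedSpace F₀ G₀]
  [LieGroup 𝓘(ℝ, E₁) ∞ H₁] [LieGroup 𝓘(ℝ, E₀) ∞ H₀]

/-- An action `(α, β)` of the crossed module `G₁ → G₀` on the crossed module `H₁ → H₀`: a crossed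
module morphism from `G₁ → G₀` to the actor crossed module `D(H₀, H₁) → Aut(H₁, H₀, ∂)`.
Smoothness of `α` and of the components of `β` means that the associated maps
`G₁ × H₀ → H₁`, `G₀ × H₁ → H₁` and `G₀ × H₀ → H₀` are smooth. -/
structure LieCrossedModule.Action (G : LieCrossedModule F₁ G₁ F₀ G₀)
    (H : LieCrossedModule E₁ H₁ E₀ H₀) where
  α : G₁ →* (H.Derivation)ˣ
  β : G₀ →* H.Aut
  contMDiff_α : ContMDiff (𝓘(ℝ, F₁).prod 𝓘(ℝ, E₀)) 𝓘(ℝ, E₁) ∞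
    (fun p : G₁ × H₀ => (α p.1).val.toFun p.2)
  contMDiff_β₁ : ContMDiff (𝓘(ℝ, F₀).prod 𝓘(ℝ, E₁)) 𝓘(ℝ, E₁) ∞
    (fun p : G₀ × H₁ => (β p.1).val.1 p.2)
  contMDiff_β₀ : ContMDiff (𝓘(ℝ, F₀).prod 𝓘(ℝ, E₀)) 𝓘(ℝ, E₀) ∞
    (fun p : G₀ × H₀ => (β p.1).val.2 p.2)
  actorBd_α : ∀ g₁ : G₁, H.actorBd (α g₁) = β (G.bd g₁)
  α_act : ∀ (g₀ : G₀) (g₁ : G₁), α (G.act g₀ g₁) = H.actorAct (β g₀) (α g₁)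

namespace LieCrossedModule.Action

variable {G : LieCrossedModule F₁ G₁ F₀ G₀} {H : LieCrossedModule E₁ H₁ E₀ H₀}

/-- The component `β₁ : G₀ → Aut(H₁)` of `β`. -/
def β₁ (A : G.Action H) : G₀ →* MulAut H₁ :=
  (MonoidHom.fst _ _).comp (H.Aut.subtype.comp A.β)

/-- The component `β₀ : G₀ → Aut(H₀)` of `β`. -/
def β₀ (A : G.Action H) : G₀ →* MulAut H₀ :=
  (MonoidHom.snd _ _).comp (H.Aut.subtype.comp A.β)

/-- `A.ev g₁ h₀ = α(g₁)h₀`. -/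
def ev (A : G.Action H) (g₁ : G₁) (h₀ : H₀) : H₁ := (A.α g₁).val.toFun h₀

end LieCrossedModule.Action

end Groups

section Operators

variable {E : Type*} [NormedAddCommGroup E] [NormedSpace ℝ E]
  {G : Type*} [Group G] [TopologicalSpace G] [ChartedSpace E G]
  {F : Type*} [NormedAddCommGroup F] [NormedSpace ℝ F]
  {H : Type*} [Group H] [TopologicalSpace H] [ChartedSpace F H]

variable (E F) in
/-- `B : H → G` is a relative Rota-Baxter operator on the Lie group `G` with respect to the
action `φ` of `G` on the Lie group `H`. -/
structure IsRelRotaBaxter (φ : G →* MulAut H) (B : H → G) : Prop where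
  contMDiff : ContMDiff 𝓘(ℝ, F) 𝓘(ℝ, E) ∞ B
  mul_eq : ∀ h h' : H, B h * B h' = B (h * φ (B h) h')

variable (E F) in
/-- `D : G → H` is a crossed homomorphism of Lie groups with respect to the action `φ` of `G`
on `H`. -/
structure IsCrossedHom (φ : G →* MulAut H) (D : G → H) : Prop where
  contMDiff : ContMDiff 𝓘(ℝ, E) 𝓘(ℝ, F) ∞ D
  map_mul : ∀ g g' : G, D (g * g') = D g * φ g (D g')

end Operators

section CrossedModuleOperators

variable {E₁ : Type*} [NormedAddCommGroup E₁] [NormedSpace ℝ E₁]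
  {G₁ : Type*} [Group G₁] [TopologicalSpace G₁] [ChartedSpace E₁ G₁]
  {E₀ : Type*} [NormedAddCommGroup E₀] [NormedSpace ℝ E₀]
  {G₀ : Type*} [Group G₀] [TopologicalSpace G₀] [ChartedSpace E₀ G₀]
  {F₁ : Type*} [NormedAddCommGroup F₁] [NormedSpace ℝ F₁]
  {H₁ : Type*} [Group H₁] [TopologicalSpace H₁] [ChartedSpace F₁ H₁]
  {F₀ : Type*} [NormedAddCommGroup F₀] [NormedSpace ℝ F₀]
  {H₀ : Type*} [Group H₀] [TopologicalSpace H₀] [ChartedSpace F₀ H₀]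
  [LieGroup 𝓘(ℝ, F₁) ∞ H₁] [LieGroup 𝓘(ℝ, F₀) ∞ H₀]
  {G : LieCrossedModule E₁ G₁ E₀ G₀} {H : LieCrossedModule F₁ H₁ F₀ H₀}

/-- `(B₁, B₀)` is a relative Rota-Baxter operator on the crossed module `G₁ → G₀` with respect to
the action `A = (α, β)` on `H₁ → H₀`. -/
structure LieCrossedModule.Action.IsRelRotaBaxter (A : G.Action H)
    (B₁ : H₁ → G₁) (B₀ : H₀ → G₀) : Prop where
  bd_comp : ∀ h₁, G.bd (B₁ h₁) = B₀ (H.bd h₁)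
  one : _root_.IsRelRotaBaxter E₁ F₁ (A.β₁.comp G.bd) B₁
  zero : _root_.IsRelRotaBaxter E₀ F₀ A.β₀ B₀
  act_eq : ∀ h₀ h₁, G.act (B₀ h₀) (B₁ h₁) =
    B₁ (H.act h₀ (A.β₁ (B₀ h₀) h₁ * A.ev (G.act (B₀ h₀) (B₁ h₁)) (h₀⁻¹)))

/-- `(D₁, D₀)` is a crossed homomorphism with respect to the action `A = (α, β)` of the crossed
module `G₁ → G₀` on `H₁ → H₀`. -/
structure LieCrossedModule.Action.IsCrossedHom (A : G.Action H)
    (D₁ : G₁ → H₁) (D₀ : G₀ → H₀) : Prop where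
  bd_comp : ∀ g₁, H.bd (D₁ g₁) = D₀ (G.bd g₁)
  one : _root_.IsCrossedHom E₁ F₁ (A.β₁.comp G.bd) D₁
  zero : _root_.IsCrossedHom E₀ F₀ A.β₀ D₀
  map_act : ∀ g₀ g₁, D₁ (G.act g₀ g₁) =
    H.act (D₀ g₀) (A.β₁ g₀ (D₁ g₁) * A.ev (G.act g₀ g₁) ((D₀ g₀)⁻¹))

end CrossedModuleOperators

/-! ### The infinitesimal side -/

section LieAlgebras

variable {𝔤 𝔥 : Type*} [LieRing 𝔤] [LieAlgebra ℝ 𝔤] [LieRing 𝔥] [LieAlgebra ℝ 𝔥]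

/-- `D : 𝔤 → 𝔥` is a crossed homomorphism of Lie algebras with respect to the action `φ` of `𝔤`
on `𝔥`. -/
def IsLieAlgCrossedHom (φ : 𝔤 →ₗ[ℝ] 𝔥 →ₗ[ℝ] 𝔥) (D : 𝔤 →ₗ[ℝ] 𝔥) : Prop :=
  ∀ x y : 𝔤, D ⁅x, y⁆ = φ x (D y) - φ y (D x) + ⁅D x, D y⁆

variable {𝔤₁ 𝔤₀ 𝔥₁ 𝔥₀ : Type*} [LieRing 𝔤₁] [LieAlgebra ℝ 𝔤₁] [LieRing 𝔤₀] [LieAlgebra ℝ 𝔤₀]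
  [LieRing 𝔥₁] [LieAlgebra ℝ 𝔥₁] [LieRing 𝔥₀] [LieAlgebra ℝ 𝔥₀]

/-- `(D₁, D₀)` is a crossed homomorphism of Lie algebra crossed modules, from
`(μ : 𝔤₁ → 𝔤₀, actG)` to `(bd : 𝔥₁ → 𝔥₀, actH)`, with respect to the action `(α, (β₁, β₀))` of the
former on the latter. -/
structure IsLieAlgCrossedModuleCrossedHom
    (μ : 𝔤₁ →ₗ[ℝ] 𝔤₀) (actG : 𝔤₀ →ₗ[ℝ] 𝔤₁ →ₗ[ℝ] 𝔤₁)
    (bd : 𝔥₁ →ₗ[ℝ] 𝔥₀) (actH : 𝔥₀ →ₗ[ℝ] 𝔥₁ →ₗ[ℝ] 𝔥₁)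
    (α : 𝔤₁ →ₗ[ℝ] 𝔥₀ →ₗ[ℝ] 𝔥₁)
    (β₁ : 𝔤₀ →ₗ[ℝ] 𝔥₁ →ₗ[ℝ] 𝔥₁) (β₀ : 𝔤₀ →ₗ[ℝ] 𝔥₀ →ₗ[ℝ] 𝔥₀)
    (D₁ : 𝔤₁ →ₗ[ℝ] 𝔥₁) (D₀ : 𝔤₀ →ₗ[ℝ] 𝔥₀) : Prop where
  bd_comp : ∀ ξ, bd (D₁ ξ) = D₀ (μ ξ)
  one : IsLieAlgCrossedHom (β₁.comp μ) D₁
  zero : IsLieAlgCrossedHom β₀ D₀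
  map_act : ∀ x ξ, D₁ (actG x ξ) = β₁ x (D₁ ξ) - α ξ (D₀ x) + actH (D₀ x) (D₁ ξ)

end LieAlgebras

section Infinitesimal

/-- Smooth real Lie groups are smooth enough for their tangent space at `1` to be a Lie algebra. -/
instance instLEInftyMinSmoothnessRealThree : ENat.LEInfty (minSmoothness ℝ 3) where
  out := by
    rw [minSmoothness_of_isRCLikeNormedField]
    exact ENat.LEInfty.out

/-- The Lie algebra of a Lie group `G` modelled on `E`: the tangent space at the identity, with
the bracket of left-invariant vector fields. -/
abbrev LieOf (E : Type*) [NormedAddCommGroup E] [NormedSpace ℝ E]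
    (G : Type*) [Group G] [TopologicalSpace G] [ChartedSpace E G] : Type _ :=
  GroupLieAlgebra 𝓘(ℝ, E) G

variable (E : Type*) [NormedAddCommGroup E] [NormedSpace ℝ E]
  {G : Type*} [Group G] [TopologicalSpace G] [ChartedSpace E G]
  (F : Type*) [NormedAddCommGroup F] [NormedSpace ℝ F]
  {H : Type*} [Group H] [TopologicalSpace H] [ChartedSpace F H]
  (F' : Type*) [NormedAddCommGroup F'] [NormedSpace ℝ F']
  {K : Type*} [Group K] [TopologicalSpace K] [ChartedSpace F' K]

variable {E F} in
/-- The differential at the identity of a map `f : G → H`, as a map between the model spaces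
(the underlying spaces of the tangent spaces at `1` and at `f 1`). -/
def mfderivOne (f : G → H) : E →L[ℝ] F := mfderiv 𝓘(ℝ, E) 𝓘(ℝ, F) f 1

/-- The differential `f_{*e}` at the identity of a smooth map `f : G → H` with `f 1 = 1`. -/
def diffOne (f : G → H) : LieOf E G →ₗ[ℝ] LieOf F H :=
  (mfderivOne f : E →L[ℝ] F).toLinearMap

/-- For a map `φ : G × H → K` with `φ(g, 1) = 1` for all `g`: the differential at `1` of the map
`G → Hom(𝔥, 𝔨)`, `g ↦ (φ(g, ·))_{*e}`. -/
def mfderivOneOne (φ : G → H → K) : E →L[ℝ] F →L[ℝ] F' :=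
  mfderiv 𝓘(ℝ, E) 𝓘(ℝ, F →L[ℝ] F') (fun g : G => (mfderivOne (φ g) : F →L[ℝ] F')) 1

/-- The infinitesimal version of a smooth map `φ : G × H → K` with `φ(g, 1) = 1` for all `g`:
the differential at `1` of the map `G → Hom(𝔥, 𝔨)`, `g ↦ (φ(g, ·))_{*e}`.  In other words
`(x, y) ↦ d/ds d/dt φ(exp(sx), exp(ty))` at `s = t = 0`. -/
def infinitesimal (φ : G → H → K) : LieOf E G →ₗ[ℝ] LieOf F H →ₗ[ℝ] LieOf F' K :=
  (LinearMap.mk₂ ℝ (fun (x : E) (y : F) => (mfderivOneOne E F F' φ x y : F'))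
    (by simp) (by simp) (by simp) (by simp) : E →ₗ[ℝ] F →ₗ[ℝ] F')

end Infinitesimal

end

/-!
The two halves of the theorem rest on different ideas.

*Inverting relative Rota-Baxter operators.*  The algebraic identities of a crossed homomorphism are
those of a relative Rota-Baxter operator read backwards, so the point is that the inverse of a
smooth bijective operator `B : H → G` is smooth.  The product `h ∘ k = h · φ(B h) k` turns `H` into
another Lie group, the descendent group, for which `B` is a homomorphism, and a bijective smooth
homomorphism out of a second countable Lie group is a diffeomorphism
(`contMDiff_inverse_of_bijective`).  Indeed, an integral curve of the left invariant vector
field with value `v ∈ ker dB₁` at `1` is mapped by `B` to a constant curve, so it is constant and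
`v = 0`: the differential `dB₁` is injective
(`injective_mfderiv_one_of_injective`); a smooth map from a second countable manifold onto a
manifold cannot raise the dimension, since locally Lipschitz maps do not increase the Hausdorff
dimension (`finrank_le_of_contMDiff_surjective`).  Hence `dB₁` is invertible; the inverse function
theorem gives smoothness of the inverse near `1`, and translations carry it to every point.

*Differentiating crossed homomorphisms.*  Everything takes place at the level of second derivatives,
in the preferred charts at the identities.  There the Lie bracket is the antisymmetrization of the
mixed second derivative of the multiplication (`bracket_eq_mixedDeriv`), and each infinitesimal
action is the mixed second derivative of the corresponding group-level map
(`mfderivOneOne_eq_mixedDeriv`).  The maps of two variables involved are affine in the charts on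
both coordinate axes, which makes the calculus of second order jets (`HasJet`)
very simple: jets of products, of actions and of `α` are given by `HasJet.mul`, `HasJet.act` and `HasJet.map₂_of_trivial`.  Comparing
the mixed second derivatives of both sides of `D(g g') = D g · φ(g) D(g')` gives
`D''(x, y) + D(m(x, y)) = m(D x, D y) + φ(x) D y`, where `m` is the mixed second derivative of the
multiplication; antisymmetrizing removes the symmetric `D''`.  In the identity for
`D₁(g₀ ▷ g₁)` the first derivative of `g₀ ▷ g₁` in `g₀` vanishes at `g₁ = 1`, so no second
derivative of `D₁` survives.
-/

open Set Filter Topology VectorField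

noncomputable section

/-! ### Maps between manifolds in charts -/

section Charts

variable {E : Type*} [NormedAddCommGroup E] [NormedSpace ℝ E]
  {G : Type*} [Group G] [TopologicalSpace G] [ChartedSpace E G]
  {F : Type*} [NormedAddCommGroup F] [NormedSpace ℝ F]
  {H : Type*} [Group H] [TopologicalSpace H] [ChartedSpace F H]

/-- A map between Lie groups read in the preferred charts at the identities. -/
def inChartsAtOne (f : G → H) : E → F :=
  extChartAt 𝓘(ℝ, F) (1 : H) ∘ f ∘ (extChartAt 𝓘(ℝ, E) (1 : G)).symm

theorem mfderivOne_eq_fderiv {f : G → H} (hf : MDifferentiableAt 𝓘(ℝ, E) 𝓘(ℝ, F) f 1)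
    (h1 : f 1 = 1) :
    (mfderivOne f : E →L[ℝ] F) = fderiv ℝ (inChartsAtOne f) (extChartAt 𝓘(ℝ, E) (1 : G) 1) := by
  have h2 : (mfderivOne f : E →L[ℝ] F) = fderivWithin ℝ
      (extChartAt 𝓘(ℝ, F) (f 1) ∘ f ∘ (extChartAt 𝓘(ℝ, E) (1 : G)).symm) (range id)
      (extChartAt 𝓘(ℝ, E) (1 : G) 1) := hf.mfderiv
  rw [h2, h1, range_id, fderivWithin_univ]
  rfl

/-- A smooth map is smooth when read in charts centred at any two points, at every point where it
can be read in them. -/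
theorem ContMDiffAt.contDiffAt_extChartAt
    {M : Type*} [TopologicalSpace M] [ChartedSpace F M] {N : Type*} [TopologicalSpace N]
    [ChartedSpace E N] {n : ℕ∞ω} [IsManifold 𝓘(ℝ, F) n M] [IsManifold 𝓘(ℝ, E) n N]
    {f : M → N} {x : M} {y : N} {z : F}
    (hz : z ∈ (extChartAt 𝓘(ℝ, F) x).target)
    (hy : f ((extChartAt 𝓘(ℝ, F) x).symm z) ∈ (chartAt E y).source)
    (hf : ContMDiffAt 𝓘(ℝ, F) 𝓘(ℝ, E) n f ((extChartAt 𝓘(ℝ, F) x).symm z)) :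
    ContDiffAt ℝ n (extChartAt 𝓘(ℝ, E) y ∘ f ∘ (extChartAt 𝓘(ℝ, F) x).symm) z := by
  rw [← contMDiffAt_iff_contDiffAt]
  have h1 := (contMDiffOn_extChartAt_symm (I := 𝓘(ℝ, F)) (n := n) x).contMDiffAt
    ((isOpen_extChartAt_target x).mem_nhds hz)
  exact (contMDiffAt_extChartAt' hy).comp z (hf.comp z h1)

theorem ContMDiff.contDiffAt_inChartsAtOne [LieGroup 𝓘(ℝ, E) ∞ G] [LieGroup 𝓘(ℝ, F) ∞ H]
    {f : G → H} (hf : ContMDiff 𝓘(ℝ, E) 𝓘(ℝ, F) ∞ f) (h1 : f 1 = 1) :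
    ContDiffAt ℝ ∞ (inChartsAtOne f : E → F) (extChartAt 𝓘(ℝ, E) (1 : G) 1) := by
  refine ContMDiffAt.contDiffAt_extChartAt (mem_extChartAt_target _) ?_ hf.contMDiffAt
  rw [extChartAt_to_inv, h1]
  exact mem_chart_source F 1

/-- A smooth surjection from a second countable manifold does not raise the dimension: read in
countably many charts it is locally Lipschitz, so it does not raise the Hausdorff dimension. -/
theorem finrank_le_of_contMDiff_surjective [FiniteDimensional ℝ E] [FiniteDimensional ℝ F]
    {M : Type*} [TopologicalSpace M] [ChartedSpace F M] [IsManifold 𝓘(ℝ, F) 1 M]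
    [SecondCountableTopology M] {N : Type*} [TopologicalSpace N] [ChartedSpace E N]
    [IsManifold 𝓘(ℝ, E) 1 N] [Nonempty N] {f : M → N}
    (hf : ContMDiff 𝓘(ℝ, F) 𝓘(ℝ, E) 1 f) (hsurj : Function.Surjective f) :
    Module.finrank ℝ E ≤ Module.finrank ℝ F := by
  obtain ⟨y⟩ := ‹Nonempty N›
  let T : M → Set F := fun x => (extChartAt 𝓘(ℝ, F) x).target ∩
    (f ∘ (extChartAt 𝓘(ℝ, F) x).symm) ⁻¹' (chartAt E y).source
  let g : M → F → E := fun x => extChartAt 𝓘(ℝ, E) y ∘ f ∘ (extChartAt 𝓘(ℝ, F) x).symm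
  obtain ⟨s, hs, hcover⟩ := TopologicalSpace.countable_cover_nhds
    (fun x : M => (chartAt F x).open_source.mem_nhds (mem_chart_source F x))
  have hsub : (extChartAt 𝓘(ℝ, E) y).target ⊆ ⋃ x ∈ s, g x '' T x := by
    intro z hz
    obtain ⟨m, hm⟩ := hsurj ((extChartAt 𝓘(ℝ, E) y).symm z)
    obtain ⟨x, hx, hmx⟩ := mem_iUnion₂.1 (hcover.symm ▸ mem_univ m)
    have hmx' : m ∈ (extChartAt 𝓘(ℝ, F) x).source := by simpa using hmx
    have hleft := (extChartAt 𝓘(ℝ, F) x).left_inv hmx'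
    refine mem_iUnion₂.2 ⟨x, hx, extChartAt 𝓘(ℝ, F) x m,
      ⟨(extChartAt 𝓘(ℝ, F) x).map_source hmx', ?_⟩, ?_⟩
    · have := (extChartAt 𝓘(ℝ, E) y).map_target hz
      simp only [mem_preimage, Function.comp_apply, hleft, hm]
      simpa only [extChartAt_source] using this
    · simp only [g, Function.comp_apply, hleft, hm]
      exact (extChartAt 𝓘(ℝ, E) y).right_inv hz
  have hle : ∀ x, dimH (g x '' T x) ≤ Module.finrank ℝ F := by
    intro x
    refine (dimH_image_le_of_locally_lipschitzOn fun z hz => ?_).trans ((dimH_mono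
      (subset_univ _)).trans_eq (Real.dimH_univ_eq_finrank F))
    obtain ⟨C, t, ht, hC⟩ := (ContMDiffAt.contDiffAt_extChartAt hz.1 hz.2
      hf.contMDiffAt).exists_lipschitzOnWith
    exact ⟨C, t, mem_nhdsWithin_of_mem_nhds ht, hC⟩
  have h := dimH_mono hsub
  rw [Real.dimH_of_mem_nhds ((isOpen_extChartAt_target y).mem_nhds (mem_extChartAt_target y)),
    dimH_bUnion hs] at h
  exact_mod_cast h.trans (iSup₂_le fun x _ => hle x)

end Charts

/-! ### Bijective smooth homomorphisms of Lie groups -/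

section Homomorphisms

variable {E : Type*} [NormedAddCommGroup E] [NormedSpace ℝ E]
  {G : Type*} [Group G] [TopologicalSpace G] [ChartedSpace E G] [LieGroup 𝓘(ℝ, E) ∞ G]
  {F : Type*} [NormedAddCommGroup F] [NormedSpace ℝ F]
  {H : Type*} [Group H] [TopologicalSpace H] [ChartedSpace F H] [LieGroup 𝓘(ℝ, F) ∞ H]

/-- A smooth homomorphism whose differential at `1` kills `v` kills the left invariant vector field
defined by `v` everywhere. -/
theorem mfderiv_mulInvariantVectorField_eq_zero {f : H →* G}
    (hf : ContMDiff 𝓘(ℝ, F) 𝓘(ℝ, E) ∞ f) {v : GroupLieAlgebra 𝓘(ℝ, F) H}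
    (hv : mfderiv 𝓘(ℝ, F) 𝓘(ℝ, E) f 1 v = 0) (h : H) :
    mfderiv 𝓘(ℝ, F) 𝓘(ℝ, E) f h (mulInvariantVectorField v h) = 0 := by
  have hd := hf.mdifferentiable (by simp)
  have hL : MDifferentiableAt 𝓘(ℝ, F) 𝓘(ℝ, F) (h * ·) (1 : H) :=
    (contMDiff_mul_left (I := 𝓘(ℝ, F)) (n := ∞)).mdifferentiable (by simp) 1
  have hL' : MDifferentiableAt 𝓘(ℝ, E) 𝓘(ℝ, E) (f h * ·) (f 1) :=
    (contMDiff_mul_left (I := 𝓘(ℝ, E)) (n := ∞)).mdifferentiable (by simp) (f 1)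
  have e : (f ∘ (h * ·)) = (f h * ·) ∘ f := by ext x; simp
  have h1 := mfderiv_comp (1 : H) (hd (h * 1)) hL
  have h2 := mfderiv_comp (1 : H) hL' (hd 1)
  rw [e, h2] at h1
  have h3 := congrArg (fun L => L v) h1
  simp only [ContinuousLinearMap.comp_apply] at h3
  have h4 : mfderiv 𝓘(ℝ, F) 𝓘(ℝ, E) f (h * 1) (mulInvariantVectorField v h) = 0 := by
    refine h3.symm.trans ?_
    rw [hv]
    exact map_zero _
  -- the tangent spaces at `h * 1` and `h` have to be identified by transport along `mul_one`
  have h5 : ∀ k, k = h →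
      (mfderiv 𝓘(ℝ, F) 𝓘(ℝ, E) f k : F →L[ℝ] E) (mulInvariantVectorField v h) = 0 →
      (mfderiv 𝓘(ℝ, F) 𝓘(ℝ, E) f h : F →L[ℝ] E) (mulInvariantVectorField v h) = 0 := by
    rintro _ rfl h; exact h
  exact h5 _ (mul_one h) h4

/-- An injective smooth homomorphism of Lie groups is an immersion at `1`: it maps the integral
curves of a left invariant vector field that it kills to points. -/
theorem injective_mfderiv_one_of_injective [CompleteSpace F] {f : H →* G}
    (hf : ContMDiff 𝓘(ℝ, F) 𝓘(ℝ, E) ∞ f) (hinj : Function.Injective f) :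
    Function.Injective (mfderivOne f : F →L[ℝ] E) := by
  rw [injective_iff_map_eq_zero]
  intro (v : GroupLieAlgebra 𝓘(ℝ, F) H) hv
  have : LieGroup 𝓘(ℝ, F) (minSmoothness ℝ 3) H := inferInstance
  have hV := contMDiffAt_mulInvariantVectorField (I := 𝓘(ℝ, F)) (G := H) v (g := 1)
  obtain ⟨γ, hγ0, hγ⟩ := exists_isMIntegralCurveAt_of_contMDiffAt_boundaryless (0 : ℝ)
    (hV.of_le (by simp [minSmoothness_of_isRCLikeNormedField]))
  have hd := hf.mdifferentiable (by simp)
  -- the derivative of `f ∘ γ` vanishes, so `f ∘ γ` is locally constant, and so is `γ`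
  have hfγ : ∀ᶠ t in 𝓝 (0 : ℝ), HasMFDerivAt 𝓘(ℝ, ℝ) 𝓘(ℝ, E) (f ∘ γ) t 0 := by
    filter_upwards [hγ] with t ht
    have := (hd (γ t)).hasMFDerivAt.comp t ht
    have h0 := mfderiv_mulInvariantVectorField_eq_zero hf (v := v) hv (γ t)
    refine this.congr_mfderiv (ContinuousLinearMap.ext_ring ?_)
    exact (congrArg (mfderiv 𝓘(ℝ, F) 𝓘(ℝ, E) f (γ t) : F →L[ℝ] E)
      (one_smul ℝ (mulInvariantVectorField v (γ t) : F))).trans h0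
  have hγc : ContinuousAt γ 0 := hγ.self_of_nhds.continuousAt
  have hsrc : ∀ᶠ t in 𝓝 (0 : ℝ), f (γ t) ∈ (chartAt E (1 : G)).source := by
    have : ContinuousAt (f ∘ γ) 0 := hf.continuous.continuousAt.comp hγc
    refine this.eventually ((chartAt E (1 : G)).open_source.mem_nhds ?_)
    simp [hγ0]
  have hκ : ∀ᶠ t in 𝓝 (0 : ℝ),
      HasFDerivAt (extChartAt 𝓘(ℝ, E) (1 : G) ∘ f ∘ γ) (0 : ℝ →L[ℝ] E) t := by
    filter_upwards [hfγ, hsrc] with t ht hs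
    have := (mdifferentiableAt_extChartAt (I := 𝓘(ℝ, E)) hs).hasMFDerivAt.comp t ht
    exact (this.congr_mfderiv (ContinuousLinearMap.comp_zero _)).hasFDerivAt
  obtain ⟨ε, hε, hball⟩ := Metric.eventually_nhds_iff_ball.1 (hκ.and hsrc)
  have hconst : ∀ t ∈ Metric.ball (0 : ℝ) ε, γ t = 1 := by
    intro t ht
    have h0 : (0 : ℝ) ∈ Metric.ball (0 : ℝ) ε := Metric.mem_ball_self hε
    have := (convex_ball (0 : ℝ) ε).is_const_of_fderivWithin_eq_zero (𝕜 := ℝ)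
      (f := extChartAt 𝓘(ℝ, E) (1 : G) ∘ f ∘ γ)
      (fun s hs => (hball s hs).1.differentiableAt.differentiableWithinAt)
      (fun s hs => by
        rw [fderivWithin_of_isOpen Metric.isOpen_ball hs]; exact (hball s hs).1.fderiv) ht h0
    have h2 := (extChartAt 𝓘(ℝ, E) (1 : G)).injOn (by simpa using (hball t ht).2)
      (by simpa using (hball 0 h0).2) this
    rw [hinj h2, hγ0]
  have hev : γ =ᶠ[𝓝 0] fun _ => 1 := by
    filter_upwards [Metric.ball_mem_nhds (0 : ℝ) hε] with t ht using hconst t ht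
  have hc : HasMFDerivAt 𝓘(ℝ, ℝ) 𝓘(ℝ, F) γ 0 (0 : ℝ →L[ℝ] F) := by
    have h := hasMFDerivAt_const (I := 𝓘(ℝ, ℝ)) (I' := 𝓘(ℝ, F)) (1 : H) (0 : ℝ)
    exact h.congr_of_eventuallyEq hev
  have huniq := hasMFDerivAt_unique hγ.self_of_nhds hc
  have h1 := congrArg (fun L => L (1 : ℝ)) huniq
  have h2 : (mulInvariantVectorField v (γ 0) : F) = 0 := by
    have h3 : (1 : ℝ) • (mulInvariantVectorField v (γ 0) : F) = 0 := h1
    simpa using h3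
  rw [hγ0] at h2
  have h4 : (mulInvariantVectorField v (1 : H) : F) = v := by
    have h5 : ((1 : H) * ·) = id := funext one_mul
    have h6 : (mfderiv 𝓘(ℝ, F) 𝓘(ℝ, F) ((1 : H) * ·) (1 : H) : F →L[ℝ] F) =
        ContinuousLinearMap.id ℝ F := by
      rw [h5]; exact mfderiv_id
    exact congrArg (fun L : F →L[ℝ] F => L v) h6
  exact h4.symm.trans h2

/-- A bijective smooth homomorphism from a second countable Lie group has a smooth inverse. -/
theorem contMDiff_inverse_of_bijective [FiniteDimensional ℝ E] [FiniteDimensional ℝ F]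
    [SecondCountableTopology H] {f : H →* G} (hf : ContMDiff 𝓘(ℝ, F) 𝓘(ℝ, E) ∞ f) {D : G → H}
    (hl : Function.LeftInverse D f) (hr : Function.RightInverse D f) :
    ContMDiff 𝓘(ℝ, E) 𝓘(ℝ, F) ∞ D := by
  set κH := extChartAt 𝓘(ℝ, F) (1 : H) with hκH
  set κG := extChartAt 𝓘(ℝ, E) (1 : G) with hκG
  have hinj := injective_mfderiv_one_of_injective hf hl.injective
  have hle : Module.finrank ℝ E ≤ Module.finrank ℝ F :=
    finrank_le_of_contMDiff_surjective (hf.of_le (by norm_num)) hr.surjective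
  have hge : Module.finrank ℝ F ≤ Module.finrank ℝ E :=
    LinearMap.finrank_le_finrank_of_injective (f := (mfderivOne f : F →L[ℝ] E).toLinearMap) hinj
  let L : F ≃L[ℝ] E := (LinearEquiv.ofInjectiveOfFinrankEq
    (mfderivOne f : F →L[ℝ] E).toLinearMap hinj (le_antisymm hge hle)).toContinuousLinearEquiv
  have hL : (L : F →L[ℝ] E) = fderiv ℝ (inChartsAtOne f) (κH 1) := by
    rw [← mfderivOne_eq_fderiv (hf.mdifferentiable (by simp) 1) (map_one f)]
    ext; rfl
  have hfs : ContDiffAt ℝ ∞ (inChartsAtOne f : F → E) (κH 1) :=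
    hf.contDiffAt_inChartsAtOne (map_one f)
  have hfd : HasFDerivAt (inChartsAtOne f : F → E) (L : F →L[ℝ] E) (κH 1) :=
    hL ▸ (hfs.differentiableAt (by simp)).hasFDerivAt
  let φ := hfs.toOpenPartialHomeomorph _ hfd (by simp)
  have hφ : ∀ z, φ z = κG (f (κH.symm z)) := fun _ => rfl
  have hφ1 : φ (κH 1) = κG 1 := by
    rw [hφ, extChartAt_to_inv, map_one]
  have hmem : κH 1 ∈ φ.source := hfs.mem_toOpenPartialHomeomorph_source hfd (by simp)
  have hmem' : κG 1 ∈ φ.target := hφ1 ▸ φ.map_source hmem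
  have hsymm : φ.symm (κG 1) = κH 1 := by rw [← hφ1, φ.left_inv hmem]
  have hsm : ContDiffAt ℝ ∞ φ.symm (κG 1) := by
    have := hfs.to_localInverse hfd (by simp)
    exact hφ1 ▸ this
  have hloc : ContMDiffAt 𝓘(ℝ, E) 𝓘(ℝ, F) ∞ (fun g => κH.symm (φ.symm (κG g))) (1 : G) := by
    have h1 := (contMDiffOn_extChartAt_symm (I := 𝓘(ℝ, F)) (n := ∞) (1 : H)).contMDiffAt
      ((isOpen_extChartAt_target (1 : H)).mem_nhds (mem_extChartAt_target (1 : H)))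
    refine ContMDiffAt.comp (1 : G) (g := κH.symm) (hsymm ▸ h1) ?_
    exact ContMDiffAt.comp (1 : G) (g := φ.symm) hsm.contMDiffAt contMDiffAt_extChartAt
  -- near `1`, the inverse `D` is the local inverse of the inverse function theorem
  have hev : D =ᶠ[𝓝 1] fun g => κH.symm (φ.symm (κG g)) := by
    have hc1 : ContinuousAt κG (1 : G) := continuousAt_extChartAt 1
    have hc3 : ContinuousAt (fun g => f (κH.symm (φ.symm (κG g)))) (1 : G) :=
      hf.continuous.continuousAt.comp hloc.continuousAt
    filter_upwards [hc1.eventually (φ.open_target.mem_nhds hmem'),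
      hc3.eventually ((isOpen_extChartAt_source (I := 𝓘(ℝ, E)) (1 : G)).mem_nhds
        (by
          change f (κH.symm (φ.symm (κG 1))) ∈ κG.source
          rw [hsymm, extChartAt_to_inv, map_one]; exact mem_extChartAt_source 1)),
      extChartAt_source_mem_nhds (I := 𝓘(ℝ, E)) (1 : G)] with g h1 h3 h4
    have h5 : κG (f (κH.symm (φ.symm (κG g)))) = κG g := by
      rw [← hφ, φ.right_inv h1]
    have h6 := κG.injOn h3 h4 h5
    rw [← hl (κH.symm (φ.symm (κG g))), h6]
  have hone : ContMDiffAt 𝓘(ℝ, E) 𝓘(ℝ, F) ∞ D 1 := hloc.congr_of_eventuallyEq hev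
  -- `D` is a homomorphism, so it commutes with translations
  intro g
  have e : D = (D g * ·) ∘ D ∘ (g⁻¹ * ·) := by
    ext k
    apply hl.injective
    simp [hr _]
  rw [e]
  refine (contMDiff_mul_left (I := 𝓘(ℝ, F)) (n := ∞) (a := D g)).contMDiffAt.comp g ?_
  refine ContMDiffAt.comp g ?_ (contMDiff_mul_left (I := 𝓘(ℝ, E)) (n := ∞)).contMDiffAt
  simpa using hone

end Homomorphisms

/-! ### The descendent group of a relative Rota-Baxter operator -/

section Descendent

variable {E : Type*} [NormedAddCommGroup E] [NormedSpace ℝ E]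
  {G : Type*} [Group G] [TopologicalSpace G] [ChartedSpace E G]
  {F : Type*} [NormedAddCommGroup F] [NormedSpace ℝ F]
  {H : Type*} [Group H] [TopologicalSpace H] [ChartedSpace F H]
  {φ : G →* MulAut H} {B : H → G}

namespace IsRelRotaBaxter

theorem map_one (hB : IsRelRotaBaxter E F φ B) : B 1 = 1 := by
  have := hB.mul_eq 1 1
  simpa using this

/-- The descendent group of a relative Rota-Baxter operator `B : H → G`: the manifold `H` with
the product `h ∘ k = h · φ(B h) k`. -/
def Descendent (_ : IsRelRotaBaxter E F φ B) : Type _ := H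

variable (hB : IsRelRotaBaxter E F φ B)

instance : TopologicalSpace hB.Descendent := inferInstanceAs (TopologicalSpace H)

instance : ChartedSpace F hB.Descendent := inferInstanceAs (ChartedSpace F H)

instance [SecondCountableTopology H] : SecondCountableTopology hB.Descendent :=
  inferInstanceAs (SecondCountableTopology H)

/-- The inverse of `h` in the descendent group is `φ(B h)⁻¹ h⁻¹`; `B` maps it to `(B h)⁻¹`. -/
theorem map_inv_act (hB : IsRelRotaBaxter E F φ B) (h : H) : B ((φ (B h))⁻¹ h⁻¹) = (B h)⁻¹ := by
  rw [eq_comm, inv_eq_iff_mul_eq_one, hB.mul_eq]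
  simp [hB.map_one]

instance : Group hB.Descendent :=
  @Group.ofLeftAxioms H ⟨fun h k => h * φ (B h) k⟩ ⟨fun h => (φ (B h))⁻¹ h⁻¹⟩ ⟨1⟩
    (fun h k l => by
      change h * φ (B h) k * φ (B (h * φ (B h) k)) l = h * φ (B h) (k * φ (B k) l)
      rw [← hB.mul_eq, _root_.map_mul, _root_.map_mul, MulAut.mul_apply, mul_assoc])
    (fun h => by
      change 1 * φ (B 1) h = h
      simp [hB.map_one])
    (fun h => by
      change (φ (B h))⁻¹ h⁻¹ * φ (B ((φ (B h))⁻¹ h⁻¹)) h = 1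
      rw [hB.map_inv_act, _root_.map_inv φ, ← _root_.map_mul, inv_mul_cancel, _root_.map_one])

/-- A relative Rota-Baxter operator, as a homomorphism on its descendent group. -/
def toMonoidHom : hB.Descendent →* G where
  toFun := B
  map_one' := hB.map_one
  map_mul' h k := (hB.mul_eq h k).symm

theorem lieGroup_descendent [LieGroup 𝓘(ℝ, E) ∞ G] [LieGroup 𝓘(ℝ, F) ∞ H]
    (hφ : ContMDiff (𝓘(ℝ, E).prod 𝓘(ℝ, F)) 𝓘(ℝ, F) ∞ (fun p : G × H => φ p.1 p.2)) :
    LieGroup 𝓘(ℝ, F) ∞ hB.Descendent :=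
  { (inferInstanceAs (IsManifold 𝓘(ℝ, F) ∞ H) : IsManifold 𝓘(ℝ, F) ∞ hB.Descendent) with
    contMDiff_mul := by
      have : ContMDiff (𝓘(ℝ, F).prod 𝓘(ℝ, F)) 𝓘(ℝ, F) ∞
          (fun p : H × H => p.1 * φ (B p.1) p.2) :=
        contMDiff_fst.mul (hφ.comp ((hB.contMDiff.comp contMDiff_fst).prodMk contMDiff_snd))
      exact this
    contMDiff_inv := by
      have : ContMDiff 𝓘(ℝ, F) 𝓘(ℝ, F) ∞ (fun h : H => φ (B h)⁻¹ h⁻¹) :=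
        hφ.comp (hB.contMDiff.inv.prodMk (contMDiff_id.inv))
      have e : (fun h : H => φ (B h)⁻¹ h⁻¹) = fun h => (φ (B h))⁻¹ h⁻¹ :=
        funext fun h => by rw [_root_.map_inv φ]
      rw [e] at this
      exact this }

/-- The inverse of a bijective relative Rota-Baxter operator is a crossed homomorphism. -/
theorem isCrossedHom_inverse (hB : IsRelRotaBaxter E F φ B)
    [LieGroup 𝓘(ℝ, E) ∞ G] [LieGroup 𝓘(ℝ, F) ∞ H]
    [FiniteDimensional ℝ E] [FiniteDimensional ℝ F] [SecondCountableTopology H]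
    (hφ : ContMDiff (𝓘(ℝ, E).prod 𝓘(ℝ, F)) 𝓘(ℝ, F) ∞ (fun p : G × H => φ p.1 p.2))
    {D : G → H} (hl : Function.LeftInverse D B) (hr : Function.RightInverse D B) :
    IsCrossedHom E F φ D where
  contMDiff := by
    have := hB.lieGroup_descendent hφ
    have hsm : ContMDiff 𝓘(ℝ, F) 𝓘(ℝ, E) ∞ hB.toMonoidHom := hB.contMDiff
    exact contMDiff_inverse_of_bijective hsm hl hr
  map_mul g g' := by
    apply hl.injective
    have := hB.mul_eq (D g) (D g')
    rw [hr, hr] at this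
    rw [hr, this]

end IsRelRotaBaxter

end Descendent

section CrossedModules

variable {E₁ : Type*} [NormedAddCommGroup E₁] [NormedSpace ℝ E₁] [FiniteDimensional ℝ E₁]
  {G₁ : Type*} [Group G₁] [TopologicalSpace G₁] [ChartedSpace E₁ G₁] [LieGroup 𝓘(ℝ, E₁) ∞ G₁]
  {E₀ : Type*} [NormedAddCommGroup E₀] [NormedSpace ℝ E₀] [FiniteDimensional ℝ E₀]
  {G₀ : Type*} [Group G₀] [TopologicalSpace G₀] [ChartedSpace E₀ G₀] [LieGroup 𝓘(ℝ, E₀) ∞ G₀]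
  {F₁ : Type*} [NormedAddCommGroup F₁] [NormedSpace ℝ F₁] [FiniteDimensional ℝ F₁]
  {H₁ : Type*} [Group H₁] [TopologicalSpace H₁] [ChartedSpace F₁ H₁] [LieGroup 𝓘(ℝ, F₁) ∞ H₁]
  {F₀ : Type*} [NormedAddCommGroup F₀] [NormedSpace ℝ F₀] [FiniteDimensional ℝ F₀]
  {H₀ : Type*} [Group H₀] [TopologicalSpace H₀] [ChartedSpace F₀ H₀] [LieGroup 𝓘(ℝ, F₀) ∞ H₀]
  {G : LieCrossedModule E₁ G₁ E₀ G₀} {H : LieCrossedModule F₁ H₁ F₀ H₀} {A : G.Action H}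

/-- The inverse of a bijective relative Rota-Baxter operator on a crossed module is a crossed
homomorphism. -/
theorem LieCrossedModule.Action.IsRelRotaBaxter.isCrossedHom_inverse
    [SecondCountableTopology H₁] [SecondCountableTopology H₀]
    {B₁ : H₁ → G₁} {B₀ : H₀ → G₀} {D₁ : G₁ → H₁} {D₀ : G₀ → H₀} (hB : A.IsRelRotaBaxter B₁ B₀)
    (hl₁ : Function.LeftInverse D₁ B₁) (hr₁ : Function.RightInverse D₁ B₁)
    (hl₀ : Function.LeftInverse D₀ B₀) (hr₀ : Function.RightInverse D₀ B₀) :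
    A.IsCrossedHom D₁ D₀ where
  bd_comp g₁ := by
    apply hl₀.injective
    rw [hr₀, ← hB.bd_comp, hr₁]
  one := hB.one.isCrossedHom_inverse
    (A.contMDiff_β₁.comp ((G.contMDiff_bd.comp contMDiff_fst).prodMk contMDiff_snd)) hl₁ hr₁
  zero := hB.zero.isCrossedHom_inverse A.contMDiff_β₀ hl₀ hr₀
  map_act g₀ g₁ := by
    apply hl₁.injective
    have := hB.act_eq (D₀ g₀) (D₁ g₁)
    rw [hr₀, hr₁] at this
    rw [hr₁]
    exact this

end CrossedModules

/-! ### Second derivatives in normed spaces -/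

section SecondDerivative

variable {E : Type*} [NormedAddCommGroup E] [NormedSpace ℝ E]
  {F : Type*} [NormedAddCommGroup F] [NormedSpace ℝ F]
  {F' : Type*} [NormedAddCommGroup F'] [NormedSpace ℝ F']

/-- The second derivative of a map between normed spaces, as a bilinear map; in `sndFDeriv f x u v`
the derivative in the direction `v` is taken first. -/
def sndFDeriv (f : E → F) (x : E) : E →L[ℝ] E →L[ℝ] F := fderiv ℝ (fderiv ℝ f) x

theorem Filter.EventuallyEq.sndFDeriv_eq {f g : E → F} {x : E} (h : f =ᶠ[𝓝 x] g) :
    sndFDeriv f x = sndFDeriv g x :=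
  h.fderiv.fderiv_eq

theorem ContDiffAt.differentiableAt_fderiv {f : E → F} {x : E} (hf : ContDiffAt ℝ 2 f x) :
    DifferentiableAt ℝ (fderiv ℝ f) x :=
  (hf.fderiv_right (m := 1) (by norm_num)).differentiableAt (by norm_num)

theorem sndFDeriv_comm {f : E → F} {x : E} (hf : ContDiffAt ℝ 2 f x) (u v : E) :
    sndFDeriv f x u v = sndFDeriv f x v u :=
  hf.isSymmSndFDerivAt (by simp [minSmoothness_of_isRCLikeNormedField]) u v

theorem sndFDeriv_comp {f : F → F'} {g : E → F} {x : E} (hf : ContDiffAt ℝ 2 f (g x))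
    (hg : ContDiffAt ℝ 2 g x) (u v : E) :
    sndFDeriv (f ∘ g) x u v =
      sndFDeriv f (g x) (fderiv ℝ g x u) (fderiv ℝ g x v) +
        fderiv ℝ f (g x) (sndFDeriv g x u v) := by
  have hg1 := hg.differentiableAt (by norm_num)
  have hev : fderiv ℝ (f ∘ g) =ᶠ[𝓝 x] fun y => (fderiv ℝ f (g y)).comp (fderiv ℝ g y) := by
    have h1 := hg.continuousAt.eventually (hf.eventually (by simp))
    filter_upwards [h1, hg.eventually (by simp)] with y hy hy'
    exact fderiv_comp y (hy.differentiableAt (by norm_num)) (hy'.differentiableAt (by norm_num))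
  have h2 : HasFDerivAt (fun y => fderiv ℝ f (g y)) ((sndFDeriv f (g x)).comp (fderiv ℝ g x)) x :=
    hf.differentiableAt_fderiv.hasFDerivAt.comp x hg1.hasFDerivAt
  have h3 := h2.clm_comp hg.differentiableAt_fderiv.hasFDerivAt
  rw [sndFDeriv, hev.fderiv_eq, h3.fderiv]
  simp [sndFDeriv, add_comm]

theorem sndFDeriv_clm_add_const (L : E →L[ℝ] F) (c : F) (x : E) :
    sndFDeriv (fun y => L y + c) x = 0 := by
  have : fderiv ℝ (fun y => L y + c) = fun _ => L := by
    funext y; rw [fderiv_add_const, L.fderiv]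
  rw [sndFDeriv, this, fderiv_const_apply]

theorem sndFDeriv_clm (L : E →L[ℝ] F) (x : E) : sndFDeriv L x = 0 := by
  simpa using sndFDeriv_clm_add_const L 0 x

theorem sndFDeriv_prodMk {f : E → F} {g : E → F'} {x : E} (hf : ContDiffAt ℝ 2 f x)
    (hg : ContDiffAt ℝ 2 g x) (u v : E) :
    sndFDeriv (fun y => (f y, g y)) x u v = (sndFDeriv f x u v, sndFDeriv g x u v) := by
  have h1 := sndFDeriv_comp (f := ContinuousLinearMap.fst ℝ F F')
    (ContinuousLinearMap.contDiff _).contDiffAt (hf.prodMk hg) u v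
  have h2 := sndFDeriv_comp (f := ContinuousLinearMap.snd ℝ F F')
    (ContinuousLinearMap.contDiff _).contDiffAt (hf.prodMk hg) u v
  rw [sndFDeriv_clm, ContinuousLinearMap.fderiv] at h1 h2
  have e1 : (ContinuousLinearMap.fst ℝ F F' ∘ fun y => (f y, g y)) = f := rfl
  have e2 : (ContinuousLinearMap.snd ℝ F F' ∘ fun y => (f y, g y)) = g := rfl
  rw [e1] at h1
  rw [e2] at h2
  refine Prod.ext ?_ ?_
  · simpa using h1.symm
  · simpa using h2.symm

/-- If `x ↦ f (J x + b)` is affine with linear part `L`, then `L` gives the first derivative of `f`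
in the directions of the range of `J`, and its second derivative vanishes there. -/
theorem fderiv_of_comp_affine {f : F → F'} {J : E →L[ℝ] F} {b : F} {x : E}
    (hf : ContDiffAt ℝ 2 f (J x + b)) {L : E →L[ℝ] F'} {c : F'}
    (h : ∀ᶠ y in 𝓝 x, f (J y + b) = L y + c) :
    (∀ u, fderiv ℝ f (J x + b) (J u) = L u) ∧
      ∀ u v, sndFDeriv f (J x + b) (J u) (J v) = 0 := by
  have hJ : fderiv ℝ (fun y => J y + b) x = J := by rw [fderiv_add_const, J.fderiv]
  have hJs : ContDiff ℝ 2 (fun y => J y + b) := J.contDiff.add contDiff_const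
  have hev : (f ∘ fun y => J y + b) =ᶠ[𝓝 x] fun y => L y + c := h
  constructor
  · intro u
    have h1 := fderiv_comp x (hf.differentiableAt (by norm_num))
      (hJs.differentiable (by norm_num) x)
    rw [hev.fderiv_eq, fderiv_add_const, L.fderiv, hJ] at h1
    exact (congrArg (fun M => M u) h1).symm
  · intro u v
    have h1 := sndFDeriv_comp (g := fun y => J y + b) (x := x) hf hJs.contDiffAt u v
    rw [hev.sndFDeriv_eq, sndFDeriv_clm_add_const, sndFDeriv_clm_add_const, hJ] at h1
    simpa using h1.symm

theorem fderiv_inl_of_affine {f : E × F → F'} {x : E} {y : F} (hf : ContDiffAt ℝ 2 f (x, y))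
    {L : E →L[ℝ] F'} {c : F'} (h : ∀ᶠ z in 𝓝 x, f (z, y) = L z + c) :
    (∀ u, fderiv ℝ f (x, y) (u, 0) = L u) ∧ ∀ u v, sndFDeriv f (x, y) (u, 0) (v, 0) = 0 := by
  have := fderiv_of_comp_affine (f := f) (J := .inl ℝ E F) (b := (0, y)) (x := x)
    (by simpa using hf) (L := L) (c := c) (by simpa using h)
  simpa using this

theorem fderiv_inr_of_affine {f : E × F → F'} {x : E} {y : F} (hf : ContDiffAt ℝ 2 f (x, y))
    {L : F →L[ℝ] F'} {c : F'} (h : ∀ᶠ z in 𝓝 y, f (x, z) = L z + c) :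
    (∀ u, fderiv ℝ f (x, y) (0, u) = L u) ∧ ∀ u v, sndFDeriv f (x, y) (0, u) (0, v) = 0 := by
  have := fderiv_of_comp_affine (f := f) (J := .inr ℝ E F) (b := (x, 0)) (x := y)
    (by simpa using hf) (L := L) (c := c) (by simpa using h)
  simpa using this

/-- If `f` is affine on both coordinate axes through `(x, y)`, its first derivative there is given
by the two linear parts and its second derivative by the mixed one. -/
theorem fderiv_of_affine {f : E × F → F'} {x : E} {y : F} (hf : ContDiffAt ℝ 2 f (x, y))
    {L : E →L[ℝ] F'} {c : F'} (h : ∀ᶠ z in 𝓝 x, f (z, y) = L z + c)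
    {L' : F →L[ℝ] F'} {c' : F'} (h' : ∀ᶠ z in 𝓝 y, f (x, z) = L' z + c') :
    (∀ u, fderiv ℝ f (x, y) u = L u.1 + L' u.2) ∧
      ∀ u v, sndFDeriv f (x, y) u v =
        sndFDeriv f (x, y) (u.1, 0) (0, v.2) + sndFDeriv f (x, y) (v.1, 0) (0, u.2) := by
  have e : ∀ u : E × F, u = (u.1, 0) + (0, u.2) := fun u => by simp
  constructor
  · intro u
    conv_lhs => rw [e u]
    rw [map_add, (fderiv_inl_of_affine hf h).1, (fderiv_inr_of_affine hf h').1]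
  · intro u v
    conv_lhs => rw [e u, e v]
    simp only [map_add, _root_.add_apply]
    rw [(fderiv_inl_of_affine hf h).2, (fderiv_inr_of_affine hf h').2,
      sndFDeriv_comm hf (0, u.2) (v.1, 0)]
    abel

end SecondDerivative

/-! ### Maps of two variables in charts, infinitesimal actions and brackets -/

section TwoVariableChartsDefs

variable {E : Type*} [NormedAddCommGroup E] [NormedSpace ℝ E]
  {G : Type*} [Group G] [TopologicalSpace G] [ChartedSpace E G]
  {F : Type*} [NormedAddCommGroup F] [NormedSpace ℝ F]
  {H : Type*} [Group H] [TopologicalSpace H] [ChartedSpace F H]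
  {F' : Type*} [NormedAddCommGroup F'] [NormedSpace ℝ F']
  {K : Type*} [Group K] [TopologicalSpace K] [ChartedSpace F' K]

variable (E G) in
/-- The point representing the identity in the preferred chart at the identity. -/
def chartOne : E := extChartAt 𝓘(ℝ, E) (1 : G) 1

/-- A map `G × H → K` between Lie groups read in the preferred charts at the identities. -/
def inChartsAtOne₂ (f : G → H → K) (p : E × F) : F' :=
  extChartAt 𝓘(ℝ, F') (1 : K) (f ((extChartAt 𝓘(ℝ, E) (1 : G)).symm p.1)
    ((extChartAt 𝓘(ℝ, F) (1 : H)).symm p.2))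

/-- The mixed second derivative of a map `G × H → K` at the identities, in the preferred charts. -/
def mixedDeriv (f : G → H → K) (x : E) (y : F) : F' :=
  sndFDeriv (inChartsAtOne₂ f : E × F → F') (chartOne E G, chartOne F H) (x, 0) (0, y)

@[simp]
theorem mixedDeriv_zero_left (f : G → H → K) (y : F) :
    mixedDeriv (E := E) (F' := F') f 0 y = 0 := by
  rw [mixedDeriv, Prod.mk_zero_zero, map_zero]
  rfl

@[simp]
theorem mixedDeriv_zero_right (f : G → H → K) (x : E) :
    mixedDeriv (F := F) (F' := F') f x 0 = 0 := by
  rw [mixedDeriv, Prod.mk_zero_zero, map_zero]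

variable (E G) in
theorem inChartsAtOne₂_mul_one : ∀ᶠ x in 𝓝 (chartOne E G),
    inChartsAtOne₂ (fun g h : G => g * h) (x, chartOne E G) = x := by
  filter_upwards [(isOpen_extChartAt_target (I := 𝓘(ℝ, E)) (1 : G)).mem_nhds
    (mem_extChartAt_target (1 : G))] with x hx
  simp only [inChartsAtOne₂, chartOne]
  rw [extChartAt_to_inv, mul_one, (extChartAt 𝓘(ℝ, E) (1 : G)).right_inv hx]

variable (E G) in
theorem inChartsAtOne₂_one_mul : ∀ᶠ x in 𝓝 (chartOne E G),
    inChartsAtOne₂ (fun g h : G => g * h) (chartOne E G, x) = x := by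
  filter_upwards [(isOpen_extChartAt_target (I := 𝓘(ℝ, E)) (1 : G)).mem_nhds
    (mem_extChartAt_target (1 : G))] with x hx
  simp only [inChartsAtOne₂, chartOne]
  rw [extChartAt_to_inv, one_mul, (extChartAt 𝓘(ℝ, E) (1 : G)).right_inv hx]

variable (E G) in
/-- The left invariant vector field with value `u` at the identity, read in the chart there. -/
def leftInvariantFieldInChart (u z : E) : E :=
  fderiv ℝ (fun y : E => inChartsAtOne₂ (F' := E) (fun g h : G => g * h) (z, y)) (chartOne E G) u

end TwoVariableChartsDefs

section TwoVariableCharts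

variable {E : Type*} [NormedAddCommGroup E] [NormedSpace ℝ E]
  {G : Type*} [Group G] [TopologicalSpace G] [ChartedSpace E G] [LieGroup 𝓘(ℝ, E) ∞ G]
  {F : Type*} [NormedAddCommGroup F] [NormedSpace ℝ F]
  {H : Type*} [Group H] [TopologicalSpace H] [ChartedSpace F H] [LieGroup 𝓘(ℝ, F) ∞ H]
  {F' : Type*} [NormedAddCommGroup F'] [NormedSpace ℝ F']
  {K : Type*} [Group K] [TopologicalSpace K] [ChartedSpace F' K] [LieGroup 𝓘(ℝ, F') ∞ K]

theorem ContMDiff.contDiffAt_inChartsAtOne₂ {f : G → H → K}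
    (hf : ContMDiff (𝓘(ℝ, E).prod 𝓘(ℝ, F)) 𝓘(ℝ, F') ∞ (fun p : G × H => f p.1 p.2))
    {x : E} {y : F} (hx : x ∈ (extChartAt 𝓘(ℝ, E) (1 : G)).target)
    (hy : y ∈ (extChartAt 𝓘(ℝ, F) (1 : H)).target)
    (hxy : f ((extChartAt 𝓘(ℝ, E) (1 : G)).symm x) ((extChartAt 𝓘(ℝ, F) (1 : H)).symm y) ∈
      (chartAt F' (1 : K)).source) :
    ContDiffAt ℝ ∞ (inChartsAtOne₂ f : E × F → F') (x, y) := by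
  rw [← contMDiffAt_iff_contDiffAt]
  have h1 := (contMDiffOn_extChartAt_symm (I := 𝓘(ℝ, E)) (n := ∞) (1 : G)).contMDiffAt
    ((isOpen_extChartAt_target (1 : G)).mem_nhds hx)
  have h2 := (contMDiffOn_extChartAt_symm (I := 𝓘(ℝ, F)) (n := ∞) (1 : H)).contMDiffAt
    ((isOpen_extChartAt_target (1 : H)).mem_nhds hy)
  have h3 : ContMDiffAt 𝓘(ℝ, E × F) 𝓘(ℝ, E) ∞
      (fun p : E × F => (extChartAt 𝓘(ℝ, E) (1 : G)).symm p.1) (x, y) :=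
    ContMDiffAt.comp (g := (extChartAt 𝓘(ℝ, E) (1 : G)).symm) (x, y) h1
      contDiff_fst.contMDiff.contMDiffAt
  have h4 : ContMDiffAt 𝓘(ℝ, E × F) 𝓘(ℝ, F) ∞
      (fun p : E × F => (extChartAt 𝓘(ℝ, F) (1 : H)).symm p.2) (x, y) :=
    ContMDiffAt.comp (g := (extChartAt 𝓘(ℝ, F) (1 : H)).symm) (x, y) h2
      contDiff_snd.contMDiff.contMDiffAt
  exact (contMDiffAt_extChartAt' hxy).comp (x, y) (hf.contMDiffAt.comp (x, y) (h3.prodMk h4))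

theorem ContMDiff.contDiffAt_inChartsAtOne₂_one {f : G → H → K}
    (hf : ContMDiff (𝓘(ℝ, E).prod 𝓘(ℝ, F)) 𝓘(ℝ, F') ∞ (fun p : G × H => f p.1 p.2))
    (h1 : f 1 1 = 1) :
    ContDiffAt ℝ ∞ (inChartsAtOne₂ f : E × F → F') (chartOne E G, chartOne F H) := by
  refine hf.contDiffAt_inChartsAtOne₂ (mem_extChartAt_target _) (mem_extChartAt_target _) ?_
  rw [chartOne, chartOne, extChartAt_to_inv, extChartAt_to_inv, h1]
  exact mem_chart_source F' 1

/-- The partial derivative of `f` in the second variable, as a function of the first one, has the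
mixed second derivative of `f` as its derivative. -/
theorem hasFDerivAt_fderiv_snd {f : E × F → F'} {x : E} {y : F} (hf : ContDiffAt ℝ 2 f (x, y)) :
    HasFDerivAt (fun z => fderiv ℝ (fun w => f (z, w)) y)
      ((ContinuousLinearMap.compL ℝ F (E × F) F' |>.flip (.inr ℝ E F)).comp
        ((sndFDeriv f (x, y)).comp (.inl ℝ E F))) x := by
  have hi : ∀ z, HasFDerivAt (fun w : F => (z, w)) (ContinuousLinearMap.inr ℝ E F) y :=
    fun z => hasFDerivAt_prodMk_right z y
  have hj : HasFDerivAt (fun z : E => (z, y)) (ContinuousLinearMap.inl ℝ E F) x :=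
    hasFDerivAt_prodMk_left x y
  have hev : (fun z => fderiv ℝ (fun w => f (z, w)) y) =ᶠ[𝓝 x]
      fun z => (fderiv ℝ f (z, y)).comp (.inr ℝ E F) := by
    have hc : ContinuousAt (fun z : E => (z, y)) x := hj.continuousAt
    filter_upwards [hc.eventually (hf.eventually (by simp))] with z hz
    exact ((hz.differentiableAt (by norm_num)).hasFDerivAt.comp y (hi z)).fderiv
  refine HasFDerivAt.congr_of_eventuallyEq ?_ hev
  have h1 : HasFDerivAt (fun z => fderiv ℝ f (z, y)) ((sndFDeriv f (x, y)).comp (.inl ℝ E F)) x :=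
    hf.differentiableAt_fderiv.hasFDerivAt.comp x hj
  exact ((ContinuousLinearMap.compL ℝ F (E × F) F').flip (.inr ℝ E F)).hasFDerivAt.comp x h1

/-- When `f g 1 = 1` for all `g`, the maps `mfderivOne (f g)` are all read in the chart at `1`, and
their derivative in `g` is the mixed second derivative in the charts. -/
theorem mfderivOneOne_eq_mixedDeriv {f : G → H → K}
    (hf : ContMDiff (𝓘(ℝ, E).prod 𝓘(ℝ, F)) 𝓘(ℝ, F') ∞ (fun p : G × H => f p.1 p.2))
    (h1 : ∀ g, f g 1 = 1) (x : E) (y : F) :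
    mfderivOneOne E F F' f x y = mixedDeriv f x y := by
  have hcd := (hf.contDiffAt_inChartsAtOne₂_one (h1 1)).of_le (ENat.LEInfty.out : (2 : ℕ∞ω) ≤ ∞)
  have hder := hasFDerivAt_fderiv_snd hcd
  have hfg : ∀ g, (mfderivOne (f g) : F →L[ℝ] F') =
      fderiv ℝ (inChartsAtOne (f g)) (chartOne F H) := by
    intro g
    refine mfderivOne_eq_fderiv ?_ (h1 g)
    exact (hf.comp (contMDiff_const.prodMk contMDiff_id)).mdifferentiable (by simp) 1
  have hloc : (fun g : G => (mfderivOne (f g) : F →L[ℝ] F')) =ᶠ[𝓝 1]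
      (fun z => fderiv ℝ (fun w => inChartsAtOne₂ f (z, w)) (chartOne F H)) ∘
        extChartAt 𝓘(ℝ, E) (1 : G) := by
    filter_upwards [extChartAt_source_mem_nhds (I := 𝓘(ℝ, E)) (1 : G)] with g hg
    rw [hfg]
    simp only [Function.comp_apply, inChartsAtOne₂, (extChartAt 𝓘(ℝ, E) (1 : G)).left_inv hg]
    rfl
  have hκ : HasMFDerivAt 𝓘(ℝ, E) 𝓘(ℝ, E) (extChartAt 𝓘(ℝ, E) (1 : G)) 1
      (ContinuousLinearMap.id ℝ E) :=
    have h := mdifferentiableAt_extChartAt (I := 𝓘(ℝ, E)) (mem_chart_source E (1 : G))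
    h.hasMFDerivAt.congr_mfderiv mfderiv_extChartAt_self
  have hfin := ((HasMFDerivAt.comp (1 : G) hder.hasMFDerivAt hκ).congr_of_eventuallyEq hloc).mfderiv
  exact congrArg (fun L : E →L[ℝ] F →L[ℝ] F' => L x y) hfin

variable (G) in
theorem mpullbackWithin_mulInvariantVectorField (u : E) {z : E}
    (hz : z ∈ (extChartAt 𝓘(ℝ, E) (1 : G)).target) :
    (mpullbackWithin 𝓘(ℝ, E) 𝓘(ℝ, E) (extChartAt 𝓘(ℝ, E) (1 : G)).symm
      (mulInvariantVectorField (G := G) u) (range 𝓘(ℝ, E)) z : E) =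
      leftInvariantFieldInChart E G u z := by
  set κ := extChartAt 𝓘(ℝ, E) (1 : G) with hκ
  set g := κ.symm z with hg
  have hgs : g ∈ (chartAt E (1 : G)).source := by
    have := κ.map_target hz
    rwa [hκ, extChartAt_source] at this
  have hinv : (mfderivWithin 𝓘(ℝ, E) 𝓘(ℝ, E) κ.symm (range 𝓘(ℝ, E)) z).inverse =
      mfderiv 𝓘(ℝ, E) 𝓘(ℝ, E) κ g :=
    ContinuousLinearMap.inverse_eq (mfderivWithin_extChartAt_symm_comp_mfderiv_extChartAt hz)
      (mfderiv_extChartAt_comp_mfderivWithin_extChartAt_symm hz)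
  have hL : MDifferentiableAt 𝓘(ℝ, E) 𝓘(ℝ, E) (g * ·) (1 : G) :=
    (contMDiff_mul_left (I := 𝓘(ℝ, E)) (n := ∞)).mdifferentiable (by simp) 1
  -- the base point `g * 1` of the chain rule is only propositionally equal to `g`
  have hκd : ∀ k, k = g → MDifferentiableAt 𝓘(ℝ, E) 𝓘(ℝ, E) κ k := by
    rintro _ rfl; exact mdifferentiableAt_extChartAt hgs
  have hcomp : ∀ k (hk : k = g * 1), k = g →
      (mfderiv 𝓘(ℝ, E) 𝓘(ℝ, E) κ k : E →L[ℝ] E)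
        ((mfderiv 𝓘(ℝ, E) 𝓘(ℝ, E) (g * ·) (1 : G) : E →L[ℝ] E) u) =
      leftInvariantFieldInChart E G u z := by
    rintro _ rfl hk
    have h1 := mfderiv_comp (1 : G) (hκd _ hk) hL
    have h2 := (MDifferentiableAt.comp (1 : G) (hκd _ hk) hL).mfderiv
    have h3 := h1.symm.trans h2
    have h4 : (mfderiv 𝓘(ℝ, E) 𝓘(ℝ, E) κ (g * 1) : E →L[ℝ] E).comp
        (mfderiv 𝓘(ℝ, E) 𝓘(ℝ, E) (g * ·) (1 : G) : E →L[ℝ] E) =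
        fderivWithin ℝ (fun y : E => inChartsAtOne₂ (F' := E) (fun g h : G => g * h) (z, y))
          (range id) (chartOne E G) := h3
    rw [range_id, fderivWithin_univ] at h4
    exact congrArg (fun L : E →L[ℝ] E => L u) h4
  refine Eq.trans ?_ (hcomp g (mul_one g).symm rfl)
  exact congrArg (fun L : E →L[ℝ] E => L (mulInvariantVectorField (G := G) u g : E)) hinv

/-- In the chart at the identity, the Lie bracket is the antisymmetrized mixed second derivative of
the multiplication: the latter is the derivative of the left invariant vector fields. -/
theorem bracket_eq_mixedDeriv (v w : LieOf E G) :
    (⁅v, w⁆ : LieOf E G) =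
      mixedDeriv (E := E) (F := E) (F' := E) (fun g h : G => g * h) v w -
      mixedDeriv (E := E) (F := E) (F' := E) (fun g h : G => g * h) w v := by
  have hcd := (ContMDiff.contDiffAt_inChartsAtOne₂_one (f := fun g h : G => g * h)
    (contMDiff_mul 𝓘(ℝ, E) ∞) (one_mul 1)).of_le (ENat.LEInfty.out : (2 : ℕ∞ω) ≤ ∞)
  have hder := hasFDerivAt_fderiv_snd hcd
  let X : E → E → E := leftInvariantFieldInChart E G
  have hX1 : ∀ u, X u (chartOne E G) = u := by
    intro u
    have h : (fun y => inChartsAtOne₂ (fun g h : G => g * h) (chartOne E G, y)) =ᶠ[𝓝 (chartOne E G)]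
      id := inChartsAtOne₂_one_mul E G
    change fderiv ℝ _ _ u = u
    rw [h.fderiv_eq, fderiv_id]
    rfl
  have hX : ∀ u x, fderiv ℝ (X u) (chartOne E G) x = mixedDeriv (fun g h : G => g * h) x u := by
    intro u x
    have h1 := ((ContinuousLinearMap.apply ℝ E u).hasFDerivAt.comp (chartOne E G) hder).fderiv
    exact congrArg (fun L : E →L[ℝ] E => L x) h1
  have hfield : ∀ u : E, (mpullbackWithin 𝓘(ℝ, E) 𝓘(ℝ, E) (extChartAt 𝓘(ℝ, E) (1 : G)).symm
      (mulInvariantVectorField (G := G) u) (range 𝓘(ℝ, E)) : E → E) =ᶠ[𝓝 (chartOne E G)] X u := by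
    intro u
    filter_upwards [(isOpen_extChartAt_target (I := 𝓘(ℝ, E)) (1 : G)).mem_nhds
      (mem_extChartAt_target (1 : G))] with z hz
    exact mpullbackWithin_mulInvariantVectorField G u hz
  have hbr : ∀ (V W V' W' : E → E), V =ᶠ[𝓝 (chartOne E G)] V' → W =ᶠ[𝓝 (chartOne E G)] W' →
      lieBracketWithin ℝ V W ((extChartAt 𝓘(ℝ, E) (1 : G)).symm ⁻¹' univ ∩ range 𝓘(ℝ, E))
        (chartOne E G) = lieBracket ℝ V' W' (chartOne E G) := by
    intro V W V' W' hV hW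
    simp only [preimage_univ, modelWithCornersSelf_coe, range_id, inter_univ, lieBracketWithin_univ]
    exact hV.lieBracket_vectorField_eq hW
  have hX2 : ∀ v w : E, lieBracket ℝ (X v) (X w) (chartOne E G) =
      mixedDeriv (fun g h : G => g * h) v w - mixedDeriv (fun g h : G => g * h) w v := by
    intro v w
    rw [lieBracket, hX, hX, hX1, hX1]
  have hid : ∀ L : E →L[ℝ] E, L = ContinuousLinearMap.id ℝ E → ∀ y, L.inverse y = y := by
    rintro _ rfl y
    rw [ContinuousLinearMap.inverse_id]
    rfl
  have hκ : (mfderiv 𝓘(ℝ, E) 𝓘(ℝ, E) (extChartAt 𝓘(ℝ, E) (1 : G)) (1 : G) : E →L[ℝ] E) =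
      ContinuousLinearMap.id ℝ E := mfderiv_extChartAt_self
  exact (hid _ hκ _).trans ((hbr _ _ _ _ (hfield v) (hfield w)).trans (hX2 v w))

end TwoVariableCharts

/-! ### Second order jets of maps into a Lie group -/

section Jets

variable {T : Type*} [NormedAddCommGroup T] [NormedSpace ℝ T]

/-- A map `a : T → G` with `a t = 1` has, in the chart at the identity, the derivatives `p` and `q`
in the directions `u` and `v` at `t`, and the mixed second derivative `r`. -/
structure HasJet {E : Type*} [NormedAddCommGroup E] [NormedSpace ℝ E]
    {G : Type*} [Group G] [TopologicalSpace G] [ChartedSpace E G]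
    (a : T → G) (t u v : T) (p q r : E) : Prop where
  continuousAt : ContinuousAt a t
  map_eq_one : a t = 1
  contDiffAt : ContDiffAt ℝ 2 (fun s => extChartAt 𝓘(ℝ, E) (1 : G) (a s)) t
  fderiv_left : fderiv ℝ (fun s => extChartAt 𝓘(ℝ, E) (1 : G) (a s)) t u = p
  fderiv_right : fderiv ℝ (fun s => extChartAt 𝓘(ℝ, E) (1 : G) (a s)) t v = q
  sndFDeriv_eq : sndFDeriv (fun s => extChartAt 𝓘(ℝ, E) (1 : G) (a s)) t u v = r

namespace HasJet

variable {E : Type*} [NormedAddCommGroup E] [NormedSpace ℝ E]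
  {G : Type*} [Group G] [TopologicalSpace G] [ChartedSpace E G] [LieGroup 𝓘(ℝ, E) ∞ G]
  {F : Type*} [NormedAddCommGroup F] [NormedSpace ℝ F]
  {H : Type*} [Group H] [TopologicalSpace H] [ChartedSpace F H] [LieGroup 𝓘(ℝ, F) ∞ H]
  {F' : Type*} [NormedAddCommGroup F'] [NormedSpace ℝ F']
  {K : Type*} [Group K] [TopologicalSpace K] [ChartedSpace F' K] [LieGroup 𝓘(ℝ, F') ∞ K]
  {t u v : T} {a : T → G} {p q r : E} {b : T → H} {p' q' r' : F}

omit [LieGroup 𝓘(ℝ, E) ∞ G] in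
theorem eventually_mem_source (ha : HasJet a t u v p q r) :
    ∀ᶠ s in 𝓝 t, a s ∈ (extChartAt 𝓘(ℝ, E) (1 : G)).source :=
  ha.continuousAt.eventually (by
    rw [ha.map_eq_one]
    exact extChartAt_source_mem_nhds (I := 𝓘(ℝ, E)) (1 : G))

omit [LieGroup 𝓘(ℝ, E) ∞ G] in
theorem chart_eq (ha : HasJet a t u v p q r) :
    extChartAt 𝓘(ℝ, E) (1 : G) (a t) = chartOne E G := by
  rw [ha.map_eq_one, chartOne]

omit [LieGroup 𝓘(ℝ, E) ∞ G] in
theorem const_one : HasJet (fun _ : T => (1 : G)) t u v (0 : E) 0 0 where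
  continuousAt := continuousAt_const
  map_eq_one := rfl
  contDiffAt := contDiffAt_const
  fderiv_left := by simp
  fderiv_right := by simp
  sndFDeriv_eq := by
    have : fderiv ℝ (fun _ : T => extChartAt 𝓘(ℝ, E) (1 : G) 1) = fun _ => 0 := by
      funext s; simp
    rw [sndFDeriv, this, fderiv_const_apply]
    rfl

omit [LieGroup 𝓘(ℝ, E) ∞ G] in
/-- The jet of the inverse of the chart at the identity, composed with a linear map. -/
theorem chart_symm (L : T →L[ℝ] E) (ht : L t = chartOne E G) :
    HasJet (fun s => (extChartAt 𝓘(ℝ, E) (1 : G)).symm (L s)) t u v (L u) (L v) 0 := by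
  have hc : ContinuousAt (extChartAt 𝓘(ℝ, E) (1 : G)).symm (L t) := by
    rw [ht]; exact continuousAt_extChartAt_symm 1
  have hev : (fun s => extChartAt 𝓘(ℝ, E) (1 : G) ((extChartAt 𝓘(ℝ, E) (1 : G)).symm (L s)))
      =ᶠ[𝓝 t] L := by
    filter_upwards [L.continuous.continuousAt.eventually
      ((isOpen_extChartAt_target (I := 𝓘(ℝ, E)) (1 : G)).mem_nhds
        (by rw [ht]; exact mem_extChartAt_target 1))] with s hs
    exact (extChartAt 𝓘(ℝ, E) (1 : G)).right_inv hs
  refine ⟨hc.comp L.continuous.continuousAt, ?_, L.contDiff.contDiffAt.congr_of_eventuallyEq hev,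
    ?_, ?_, ?_⟩
  · rw [ht, chartOne, extChartAt_to_inv]
  · rw [hev.fderiv_eq, L.fderiv]
  · rw [hev.fderiv_eq, L.fderiv]
  · rw [hev.sndFDeriv_eq, sndFDeriv_clm]
    rfl

/-- The jet of `f (a s)`, by the chain rule. -/
theorem map {f : G → H} (hf : ContMDiff 𝓘(ℝ, E) 𝓘(ℝ, F) ∞ f) (h1 : f 1 = 1)
    (ha : HasJet a t u v p q r) :
    HasJet (fun s => f (a s)) t u v (mfderivOne f p : F) (mfderivOne f q : F)
      (sndFDeriv (inChartsAtOne f) (chartOne E G) p q + mfderivOne f r) := by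
  have hfs : ContDiffAt ℝ 2 (inChartsAtOne f : E → F) (chartOne E G) :=
    (hf.contDiffAt_inChartsAtOne h1).of_le (ENat.LEInfty.out : (2 : ℕ∞ω) ≤ ∞)
  have hev : (fun s => extChartAt 𝓘(ℝ, F) (1 : H) (f (a s))) =ᶠ[𝓝 t]
      inChartsAtOne f ∘ fun s => extChartAt 𝓘(ℝ, E) (1 : G) (a s) := by
    filter_upwards [ha.eventually_mem_source] with s hs
    simp only [inChartsAtOne, Function.comp_apply, (extChartAt 𝓘(ℝ, E) (1 : G)).left_inv hs]
  rw [← ha.chart_eq] at hfs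
  have hder := mfderivOne_eq_fderiv (hf.mdifferentiable (by simp) 1) h1
  change mfderivOne f = fderiv ℝ _ (chartOne E G) at hder
  have hfd : fderiv ℝ (fun s => extChartAt 𝓘(ℝ, F) (1 : H) (f (a s))) t =
      (mfderivOne f : E →L[ℝ] F).comp
        (fderiv ℝ (fun s => extChartAt 𝓘(ℝ, E) (1 : G) (a s)) t) := by
    rw [hev.fderiv_eq, hder, ← ha.chart_eq]
    exact fderiv_comp t (hfs.differentiableAt (by norm_num))
      (ha.contDiffAt.differentiableAt (by norm_num))
  refine ⟨hf.continuous.continuousAt.comp ha.continuousAt, ?_,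
    (hfs.comp t ha.contDiffAt).congr_of_eventuallyEq hev, ?_, ?_, ?_⟩
  · rw [ha.map_eq_one, h1]
  · rw [hfd, ContinuousLinearMap.comp_apply, ha.fderiv_left]
  · rw [hfd, ContinuousLinearMap.comp_apply, ha.fderiv_right]
  · rw [hev.sndFDeriv_eq, sndFDeriv_comp (g := fun s => extChartAt 𝓘(ℝ, E) (1 : G) (a s)) hfs
      ha.contDiffAt, ha.fderiv_left, ha.fderiv_right,
      ha.sndFDeriv_eq, ha.chart_eq, hder]

/-- The jet of `f (a s) (b s)`, for a map `f : G × H → K` that is affine, in the charts, on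
`G × {1}` and on `{1} × H`. -/
theorem map₂ {f : G → H → K}
    (hf : ContMDiff (𝓘(ℝ, E).prod 𝓘(ℝ, F)) 𝓘(ℝ, F') ∞ (fun p : G × H => f p.1 p.2))
    (h1 : f 1 1 = 1) {L : E →L[ℝ] F'} {c : F'}
    (hL : ∀ᶠ x in 𝓝 (chartOne E G), inChartsAtOne₂ f (x, chartOne F H) = L x + c)
    {L' : F →L[ℝ] F'} {c' : F'}
    (hL' : ∀ᶠ y in 𝓝 (chartOne F H), inChartsAtOne₂ f (chartOne E G, y) = L' y + c')
    (ha : HasJet a t u v p q r) (hb : HasJet b t u v p' q' r') :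
    HasJet (fun s => f (a s) (b s)) t u v (L p + L' p') (L q + L' q')
      (mixedDeriv f p q' + mixedDeriv f q p' + (L r + L' r')) := by
  have hfs : ContDiffAt ℝ 2 (inChartsAtOne₂ f : E × F → F') (chartOne E G, chartOne F H) :=
    (hf.contDiffAt_inChartsAtOne₂_one h1).of_le (ENat.LEInfty.out : (2 : ℕ∞ω) ≤ ∞)
  obtain ⟨hfst, hsnd⟩ := fderiv_of_affine hfs hL hL'
  have hev : (fun s => extChartAt 𝓘(ℝ, F') (1 : K) (f (a s) (b s))) =ᶠ[𝓝 t]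
      (inChartsAtOne₂ f : E × F → F') ∘ fun s =>
        (extChartAt 𝓘(ℝ, E) (1 : G) (a s), extChartAt 𝓘(ℝ, F) (1 : H) (b s)) := by
    filter_upwards [ha.eventually_mem_source, hb.eventually_mem_source] with s hs hs'
    simp only [inChartsAtOne₂, Function.comp_apply, (extChartAt 𝓘(ℝ, E) (1 : G)).left_inv hs,
      (extChartAt 𝓘(ℝ, F) (1 : H)).left_inv hs']
  have hab := ha.contDiffAt.prodMk hb.contDiffAt
  rw [← ha.chart_eq, ← hb.chart_eq] at hfs
  have hda := ha.contDiffAt.differentiableAt (by norm_num)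
  have hdb := hb.contDiffAt.differentiableAt (by norm_num)
  have hpair : ∀ w, fderiv ℝ (fun s =>
      (extChartAt 𝓘(ℝ, E) (1 : G) (a s), extChartAt 𝓘(ℝ, F) (1 : H) (b s))) t w =
      (fderiv ℝ (fun s => extChartAt 𝓘(ℝ, E) (1 : G) (a s)) t w,
        fderiv ℝ (fun s => extChartAt 𝓘(ℝ, F) (1 : H) (b s)) t w) := by
    intro w
    rw [hda.fderiv_prodMk hdb]
    rfl
  have hfd : ∀ w, fderiv ℝ (fun s => extChartAt 𝓘(ℝ, F') (1 : K) (f (a s) (b s))) t w =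
      L (fderiv ℝ (fun s => extChartAt 𝓘(ℝ, E) (1 : G) (a s)) t w) +
        L' (fderiv ℝ (fun s => extChartAt 𝓘(ℝ, F) (1 : H) (b s)) t w) := by
    intro w
    rw [hev.fderiv_eq, fderiv_comp t (hfs.differentiableAt (by norm_num))
      (hab.differentiableAt (by norm_num)), ContinuousLinearMap.comp_apply, hpair,
      ha.chart_eq, hb.chart_eq, hfst]
  refine ⟨?_, ?_, (hfs.comp t hab).congr_of_eventuallyEq hev, ?_, ?_, ?_⟩
  · exact ContinuousAt.comp (f := fun s => (a s, b s)) hf.continuous.continuousAt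
      (ha.continuousAt.prodMk hb.continuousAt)
  · rw [ha.map_eq_one, hb.map_eq_one, h1]
  · rw [hfd, ha.fderiv_left, hb.fderiv_left]
  · rw [hfd, ha.fderiv_right, hb.fderiv_right]
  · rw [hev.sndFDeriv_eq, sndFDeriv_comp (g := fun s => (extChartAt 𝓘(ℝ, E) (1 : G) (a s),
      extChartAt 𝓘(ℝ, F) (1 : H) (b s))) hfs hab, sndFDeriv_prodMk ha.contDiffAt hb.contDiffAt,
      hpair, hpair, ha.fderiv_left, ha.fderiv_right, hb.fderiv_left, hb.fderiv_right,
      ha.sndFDeriv_eq, hb.sndFDeriv_eq, ha.chart_eq, hb.chart_eq, hfst, hsnd]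
    rfl

/-- The jet of a product: the multiplication is the identity, in the charts, on both coordinate
axes. -/
theorem mul {b : T → G} {p' q' r' : E} (ha : HasJet a t u v p q r)
    (hb : HasJet b t u v p' q' r') :
    HasJet (fun s => a s * b s) t u v (p + p') (q + q')
      (mixedDeriv (fun g h : G => g * h) p q' + mixedDeriv (fun g h : G => g * h) q p' +
        (r + r')) := by
  refine map₂ (f := fun g h : G => g * h) (contMDiff_mul 𝓘(ℝ, E) ∞) (one_mul 1)
    (L := .id ℝ E) (c := 0) (L' := .id ℝ E) (c' := 0) ?_ ?_ ha hb
  · simpa using inChartsAtOne₂_mul_one E G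
  · simpa using inChartsAtOne₂_one_mul E G

/-- The jet of an action by automorphisms: as `φ g 1 = 1` and `φ 1 h = h`, the first derivative of
`a` enters only through the infinitesimal action, and the second one not at all. -/
theorem act {φ : G →* MulAut H}
    (hφ : ContMDiff (𝓘(ℝ, E).prod 𝓘(ℝ, F)) 𝓘(ℝ, F) ∞ (fun p : G × H => φ p.1 p.2))
    (ha : HasJet a t u v p q r) (hb : HasJet b t u v p' q' r') :
    HasJet (fun s => φ (a s) (b s)) t u v p' q'
      (mfderivOneOne E F F (fun g h => φ g h) p q' + mfderivOneOne E F F (fun g h => φ g h) q p' +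
        r') := by
  have h := map₂ (f := fun g h => φ g h) hφ (map_one _)
    (L := 0) (c := chartOne F H) (L' := .id ℝ F) (c' := 0) ?_ ?_ ha hb
  · rw [mfderivOneOne_eq_mixedDeriv hφ (fun g => map_one _),
      mfderivOneOne_eq_mixedDeriv hφ (fun g => map_one _)]
    simpa using h
  · refine Eventually.of_forall fun x => ?_
    simp only [inChartsAtOne₂, chartOne, extChartAt_to_inv, map_one]
    simp
  · filter_upwards [(isOpen_extChartAt_target (I := 𝓘(ℝ, F)) (1 : H)).mem_nhds
      (mem_extChartAt_target (1 : H))] with y hy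
    simp only [inChartsAtOne₂, chartOne, extChartAt_to_inv, map_one, MulAut.one_apply,
      (extChartAt 𝓘(ℝ, F) (1 : H)).right_inv hy]
    simp

/-- The jet of a map `f : G × H → K` that is trivial on `G × {1}` and on `{1} × H`. -/
theorem map₂_of_trivial {f : G → H → K}
    (hf : ContMDiff (𝓘(ℝ, E).prod 𝓘(ℝ, F)) 𝓘(ℝ, F') ∞ (fun p : G × H => f p.1 p.2))
    (h1 : ∀ g, f g 1 = 1) (h1' : ∀ h, f 1 h = 1)
    (ha : HasJet a t u v p q r) (hb : HasJet b t u v p' q' r') :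
    HasJet (fun s => f (a s) (b s)) t u v (0 : F') 0
      (mfderivOneOne E F F' f p q' + mfderivOneOne E F F' f q p') := by
  have h := map₂ (f := f) hf (h1 1)
    (L := 0) (c := chartOne F' K) (L' := 0) (c' := chartOne F' K) ?_ ?_ ha hb
  · rw [mfderivOneOne_eq_mixedDeriv hf h1, mfderivOneOne_eq_mixedDeriv hf h1]
    simpa using h
  · refine Eventually.of_forall fun x => ?_
    simp only [inChartsAtOne₂, chartOne, extChartAt_to_inv, h1]
    simp
  · refine Eventually.of_forall fun x => ?_
    simp only [inChartsAtOne₂, chartOne, extChartAt_to_inv, h1']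
    simp

/-- The jet of an inverse: as `a s * (a s)⁻¹ = 1`, the inversion has derivative `-1` at `1`. -/
theorem inv (ha : HasJet a t u v p q r) :
    HasJet (fun s => (a s)⁻¹) t u v (-p) (-q)
      (sndFDeriv (inChartsAtOne (fun g : G => g⁻¹)) (chartOne E G) p q +
        mfderivOne (F := E) (fun g : G => g⁻¹) r) := by
  have h := ha.map (contMDiff_inv 𝓘(ℝ, E) ∞) inv_one
  have h2 := ha.mul h
  simp only [mul_inv_cancel] at h2
  have e1 := h2.fderiv_left.symm.trans (const_one (t := t) (u := u) (v := v)).fderiv_left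
  have e2 := h2.fderiv_right.symm.trans (const_one (t := t) (u := u) (v := v)).fderiv_right
  rw [neg_eq_of_add_eq_zero_right e1, neg_eq_of_add_eq_zero_right e2]
  exact h

end HasJet

end Jets

/-! ### Differentiating crossed homomorphisms -/

section Differentiation

variable {E : Type*} [NormedAddCommGroup E] [NormedSpace ℝ E]
  {G : Type*} [Group G] [TopologicalSpace G] [ChartedSpace E G]
  {F : Type*} [NormedAddCommGroup F] [NormedSpace ℝ F]
  {H : Type*} [Group H] [TopologicalSpace H] [ChartedSpace F H]
  {E' : Type*} [NormedAddCommGroup E'] [NormedSpace ℝ E']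
  {K : Type*} [Group K] [TopologicalSpace K] [ChartedSpace E' K]

theorem IsCrossedHom.map_one {φ : G →* MulAut H} {D : G → H} (hD : IsCrossedHom E F φ D) :
    D 1 = 1 := by
  simpa using hD.map_mul 1 1

variable [LieGroup 𝓘(ℝ, E) ∞ G] [LieGroup 𝓘(ℝ, F) ∞ H] [LieGroup 𝓘(ℝ, E') ∞ K]

/-- The mixed second derivatives of the two sides of `D (g * g') = D g * φ (μ g) (D g')`. -/
theorem IsCrossedHom.sndFDeriv_add {μ : G →* K} (hμ : ContMDiff 𝓘(ℝ, E) 𝓘(ℝ, E') ∞ μ)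
    {φ : K →* MulAut H}
    (hφ : ContMDiff (𝓘(ℝ, E').prod 𝓘(ℝ, F)) 𝓘(ℝ, F) ∞ (fun p : K × H => φ p.1 p.2))
    {D : G → H} (hD : IsCrossedHom E F (φ.comp μ) D) (x y : E) :
    sndFDeriv (inChartsAtOne D) (chartOne E G) x y +
      ((mfderivOne D : E →L[ℝ] F) (mixedDeriv (fun g h : G => g * h) x y)) =
    mixedDeriv (fun g h : H => g * h) ((mfderivOne D : E →L[ℝ] F) x)
        ((mfderivOne D : E →L[ℝ] F) y) +
      mfderivOneOne E' F F (fun k (h : H) => φ k h) ((mfderivOne μ : E →L[ℝ] E') x)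
        ((mfderivOne D : E →L[ℝ] F) y) := by
  have ha : HasJet (fun s : E × E => (extChartAt 𝓘(ℝ, E) (1 : G)).symm s.1)
      (chartOne E G, chartOne E G) (x, 0) (0, y) x (0 : E) 0 := .chart_symm (.fst ℝ E E) rfl
  have hb : HasJet (fun s : E × E => (extChartAt 𝓘(ℝ, E) (1 : G)).symm s.2)
      (chartOne E G, chartOne E G) (x, 0) (0, y) (0 : E) y 0 := .chart_symm (.snd ℝ E E) rfl
  have h1 := (ha.mul hb).map hD.contMDiff hD.map_one
  have h2 := (ha.map hD.contMDiff hD.map_one).mul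
    ((ha.map hμ (_root_.map_one μ)).act hφ (hb.map hD.contMDiff hD.map_one))
  have e : (fun s : E × E => D ((extChartAt 𝓘(ℝ, E) (1 : G)).symm s.1 *
      (extChartAt 𝓘(ℝ, E) (1 : G)).symm s.2)) = _ := funext fun s => hD.map_mul _ _
  rw [e] at h1
  have h3 := h1.sndFDeriv_eq.symm.trans h2.sndFDeriv_eq
  simpa [add_assoc] using h3

/-- The differential of a crossed homomorphism of Lie groups is a crossed homomorphism of Lie
algebras. The action is given as the composite of a homomorphism `μ` and an action of another
group, as is the case for `β₁ ∘ μ`. -/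
theorem IsCrossedHom.isLieAlgCrossedHom {μ : G →* K} (hμ : ContMDiff 𝓘(ℝ, E) 𝓘(ℝ, E') ∞ μ)
    {φ : K →* MulAut H}
    (hφ : ContMDiff (𝓘(ℝ, E').prod 𝓘(ℝ, F)) 𝓘(ℝ, F) ∞ (fun p : K × H => φ p.1 p.2))
    {D : G → H} [CompleteSpace E] [CompleteSpace F] (hD : IsCrossedHom E F (φ.comp μ) D) :
    IsLieAlgCrossedHom
      ((infinitesimal E' F F (fun k (h : H) => φ k h)).comp (diffOne E E' μ))
      (diffOne E F D) := by
  intro x y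
  have hD2 : ContDiffAt ℝ 2 (inChartsAtOne D : E → F) (chartOne E G) :=
    (hD.contMDiff.contDiffAt_inChartsAtOne hD.map_one).of_le (ENat.LEInfty.out : (2 : ℕ∞ω) ≤ ∞)
  -- in the difference for `(x, y)` and `(y, x)` the second derivative of `D` cancels by symmetry
  have key : ∀ x y : E,
      (mfderivOne D : E →L[ℝ] F) (mixedDeriv (fun g h : G => g * h) x y -
        mixedDeriv (fun g h : G => g * h) y x) =
      mfderivOneOne E' F F (fun k (h : H) => φ k h) ((mfderivOne μ : E →L[ℝ] E') x)
        ((mfderivOne D : E →L[ℝ] F) y) -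
      mfderivOneOne E' F F (fun k (h : H) => φ k h) ((mfderivOne μ : E →L[ℝ] E') y)
        ((mfderivOne D : E →L[ℝ] F) x) +
      (mixedDeriv (fun g h : H => g * h) ((mfderivOne D : E →L[ℝ] F) x)
          ((mfderivOne D : E →L[ℝ] F) y) -
        mixedDeriv (fun g h : H => g * h) ((mfderivOne D : E →L[ℝ] F) y)
          ((mfderivOne D : E →L[ℝ] F) x)) := by
    intro x y
    have h1 := hD.sndFDeriv_add hμ hφ x y
    have h2 := hD.sndFDeriv_add hμ hφ y x
    rw [sndFDeriv_comm hD2 y x] at h2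
    rw [map_sub, eq_sub_of_add_eq' h1, eq_sub_of_add_eq' h2]
    abel
  rw [bracket_eq_mixedDeriv x y, bracket_eq_mixedDeriv (diffOne E F D x) (diffOne E F D y)]
  exact key x y

end Differentiation

section CrossedModules

variable {E₁ : Type*} [NormedAddCommGroup E₁] [NormedSpace ℝ E₁]
  {G₁ : Type*} [Group G₁] [TopologicalSpace G₁] [ChartedSpace E₁ G₁] [LieGroup 𝓘(ℝ, E₁) ∞ G₁]
  {E₀ : Type*} [NormedAddCommGroup E₀] [NormedSpace ℝ E₀]
  {G₀ : Type*} [Group G₀] [TopologicalSpace G₀] [ChartedSpace E₀ G₀] [LieGroup 𝓘(ℝ, E₀) ∞ G₀]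
  {F₁ : Type*} [NormedAddCommGroup F₁] [NormedSpace ℝ F₁]
  {H₁ : Type*} [Group H₁] [TopologicalSpace H₁] [ChartedSpace F₁ H₁] [LieGroup 𝓘(ℝ, F₁) ∞ H₁]
  {F₀ : Type*} [NormedAddCommGroup F₀] [NormedSpace ℝ F₀]
  {H₀ : Type*} [Group H₀] [TopologicalSpace H₀] [ChartedSpace F₀ H₀] [LieGroup 𝓘(ℝ, F₀) ∞ H₀]
  {G : LieCrossedModule E₁ G₁ E₀ G₀} {H : LieCrossedModule F₁ H₁ F₀ H₀} {A : G.Action H}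
  {D₁ : G₁ → H₁} {D₀ : G₀ → H₀}

namespace LieCrossedModule.Action

omit [LieGroup 𝓘(ℝ, E₁) ∞ G₁] [LieGroup 𝓘(ℝ, E₀) ∞ G₀] in
theorem ev_one (A : G.Action H) (g : G₁) : A.ev g 1 = 1 := (A.α g).val.map_one'

omit [LieGroup 𝓘(ℝ, E₁) ∞ G₁] [LieGroup 𝓘(ℝ, E₀) ∞ G₀] in
theorem one_ev (A : G.Action H) (h : H₀) : A.ev 1 h = 1 := by
  rw [ev, map_one]
  rfl

theorem IsCrossedHom.mfderivOne_bd (hD : A.IsCrossedHom D₁ D₀) (ξ : E₁) :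
    (mfderivOne H.bd : F₁ →L[ℝ] F₀) ((mfderivOne D₁ : E₁ →L[ℝ] F₁) ξ) =
      (mfderivOne D₀ : E₀ →L[ℝ] F₀) ((mfderivOne G.bd : E₁ →L[ℝ] E₀) ξ) := by
  have ha : HasJet (extChartAt 𝓘(ℝ, E₁) (1 : G₁)).symm (chartOne E₁ G₁) ξ ξ ξ ξ 0 :=
    .chart_symm (.id ℝ E₁) rfl
  have h1 := (ha.map hD.one.contMDiff hD.one.map_one).map H.contMDiff_bd (map_one H.bd)
  have h2 := (ha.map G.contMDiff_bd (map_one G.bd)).map hD.zero.contMDiff hD.zero.map_one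
  simp only [hD.bd_comp] at h1
  exact h1.fderiv_left.symm.trans h2.fderiv_left

/-- The mixed second derivatives of the two sides of
`D₁ (g₀ ▷ g₁) = D₀ g₀ ▷ (β₁ g₀ (D₁ g₁) * α (g₀ ▷ g₁) (D₀ g₀)⁻¹)`. The sign of the term in `α` comes
from the inverse. -/
theorem IsCrossedHom.mfderivOne_act (hD : A.IsCrossedHom D₁ D₀) (x : E₀) (ξ : E₁) :
    (mfderivOne D₁ : E₁ →L[ℝ] F₁)
        (mfderivOneOne E₀ E₁ E₁ (fun g₀ (g₁ : G₁) => G.act g₀ g₁) x ξ) =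
      mfderivOneOne E₀ F₁ F₁ (fun g₀ (h₁ : H₁) => A.β₁ g₀ h₁) x
          ((mfderivOne D₁ : E₁ →L[ℝ] F₁) ξ) -
        mfderivOneOne E₁ F₀ F₁ A.ev ξ ((mfderivOne D₀ : E₀ →L[ℝ] F₀) x) +
        mfderivOneOne F₀ F₁ F₁ (fun h₀ (h₁ : H₁) => H.act h₀ h₁)
          ((mfderivOne D₀ : E₀ →L[ℝ] F₀) x) ((mfderivOne D₁ : E₁ →L[ℝ] F₁) ξ) := by
  have ha : HasJet (fun s : E₀ × E₁ => (extChartAt 𝓘(ℝ, E₀) (1 : G₀)).symm s.1)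
      (chartOne E₀ G₀, chartOne E₁ G₁) (x, 0) (0, ξ) x (0 : E₀) 0 := .chart_symm (.fst ℝ E₀ E₁) rfl
  have hb : HasJet (fun s : E₀ × E₁ => (extChartAt 𝓘(ℝ, E₁) (1 : G₁)).symm s.2)
      (chartOne E₀ G₀, chartOne E₁ G₁) (x, 0) (0, ξ) (0 : E₁) ξ 0 := .chart_symm (.snd ℝ E₀ E₁) rfl
  have hact := ha.act G.contMDiff_act hb
  have hD₀ := ha.map hD.zero.contMDiff hD.zero.map_one
  have hD₁ := hb.map hD.one.contMDiff hD.one.map_one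
  have h1 := hact.map hD.one.contMDiff hD.one.map_one
  have h2 := hD₀.act H.contMDiff_act ((ha.act (φ := A.β₁) A.contMDiff_β₁ hD₁).mul
    (hact.map₂_of_trivial (f := A.ev) A.contMDiff_α A.ev_one A.one_ev hD₀.inv))
  simp only [hD.map_act] at h1
  have h3 := h1.sndFDeriv_eq.symm.trans h2.sndFDeriv_eq
  simp only [map_zero, _root_.zero_apply, add_zero, zero_add,
    mixedDeriv_zero_right, neg_zero, map_neg] at h3
  rw [h3]
  abel

theorem IsCrossedHom.isLieAlgCrossedModuleCrossedHom [CompleteSpace E₁] [CompleteSpace E₀]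
    [CompleteSpace F₁] [CompleteSpace F₀] (hD : A.IsCrossedHom D₁ D₀) :
    IsLieAlgCrossedModuleCrossedHom
      (diffOne E₁ E₀ G.bd) (infinitesimal E₀ E₁ E₁ (fun g₀ (g₁ : G₁) => G.act g₀ g₁))
      (diffOne F₁ F₀ H.bd) (infinitesimal F₀ F₁ F₁ (fun h₀ (h₁ : H₁) => H.act h₀ h₁))
      (infinitesimal E₁ F₀ F₁ A.ev)
      (infinitesimal E₀ F₁ F₁ (fun g₀ (h₁ : H₁) => A.β₁ g₀ h₁))
      (infinitesimal E₀ F₀ F₀ (fun g₀ (h₀ : H₀) => A.β₀ g₀ h₀))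
      (diffOne E₁ F₁ D₁) (diffOne E₀ F₀ D₀) where
  bd_comp ξ := hD.mfderivOne_bd ξ
  one := hD.one.isLieAlgCrossedHom G.contMDiff_bd A.contMDiff_β₁
  zero := by
    have hzero : _root_.IsCrossedHom E₀ F₀ (A.β₀.comp (MonoidHom.id G₀)) D₀ := hD.zero
    have h := hzero.isLieAlgCrossedHom contMDiff_id A.contMDiff_β₀
    have hid : diffOne E₀ E₀ (MonoidHom.id G₀) = LinearMap.id := by
      have : (mfderivOne (MonoidHom.id G₀) : E₀ →L[ℝ] E₀) = ContinuousLinearMap.id ℝ E₀ :=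
        mfderiv_id
      exact congrArg ContinuousLinearMap.toLinearMap this
    rw [hid] at h
    exact h
  map_act x ξ := hD.mfderivOne_act x ξ

end LieCrossedModule.Action

end CrossedModules

end

theorem mainTheorem7
    {E₁ : Type*} [NormedAddCommGroup E₁] [NormedSpace ℝ E₁] [FiniteDimensional ℝ E₁]
    {G₁ : Type*} [Group G₁] [TopologicalSpace G₁] [ChartedSpace E₁ G₁]
    [LieGroup 𝓘(ℝ, E₁) ∞ G₁] [SecondCountableTopology G₁]
    {E₀ : Type*} [NormedAddCommGroup E₀] [NormedSpace ℝ E₀] [FiniteDimensional ℝ E₀]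
    {G₀ : Type*} [Group G₀] [TopologicalSpace G₀] [ChartedSpace E₀ G₀]
    [LieGroup 𝓘(ℝ, E₀) ∞ G₀] [SecondCountableTopology G₀]
    {F₁ : Type*} [NormedAddCommGroup F₁] [NormedSpace ℝ F₁] [FiniteDimensional ℝ F₁]
    {H₁ : Type*} [Group H₁] [TopologicalSpace H₁] [ChartedSpace F₁ H₁]
    [LieGroup 𝓘(ℝ, F₁) ∞ H₁] [SecondCountableTopology H₁]
    {F₀ : Type*} [NormedAddCommGroup F₀] [NormedSpace ℝ F₀] [FiniteDimensional ℝ F₀]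
    {H₀ : Type*} [Group H₀] [TopologicalSpace H₀] [ChartedSpace F₀ H₀]
    [LieGroup 𝓘(ℝ, F₀) ∞ H₀] [SecondCountableTopology H₀]
    (G : LieCrossedModule E₁ G₁ E₀ G₀) (H : LieCrossedModule F₁ H₁ F₀ H₀)
    (A : G.Action H) :
    (∀ (B₁ : H₁ → G₁) (B₀ : H₀ → G₀) (D₁ : G₁ → H₁) (D₀ : G₀ → H₀),
      A.IsRelRotaBaxter B₁ B₀ →
      Function.LeftInverse D₁ B₁ → Function.RightInverse D₁ B₁ →
      Function.LeftInverse D₀ B₀ → Function.RightInverse D₀ B₀ →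
      A.IsCrossedHom D₁ D₀) ∧
    (∀ (D₁ : G₁ → H₁) (D₀ : G₀ → H₀), A.IsCrossedHom D₁ D₀ →
      IsLieAlgCrossedModuleCrossedHom
        (diffOne E₁ E₀ G.bd) (infinitesimal E₀ E₁ E₁ (fun g₀ (g₁ : G₁) => G.act g₀ g₁))
        (diffOne F₁ F₀ H.bd) (infinitesimal F₀ F₁ F₁ (fun h₀ (h₁ : H₁) => H.act h₀ h₁))
        (infinitesimal E₁ F₀ F₁ A.ev)
        (infinitesimal E₀ F₁ F₁ (fun g₀ (h₁ : H₁) => A.β₁ g₀ h₁))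
        (infinitesimal E₀ F₀ F₀ (fun g₀ (h₀ : H₀) => A.β₀ g₀ h₀))
        (diffOne E₁ F₁ D₁) (diffOne E₀ F₀ D₀)) := by
  refine ⟨fun B₁ B₀ D₁ D₀ hB hl₁ hr₁ hl₀ hr₀ => ?_, fun D₁ D₀ hD => ?_⟩
  · exact hB.isCrossedHom_inverse hl₁ hr₁ hl₀ hr₀
  · exact hD.isLieAlgCrossedModuleCrossedHom
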